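/- Let $n\ge 0$ be an integer. Permutations are written as words $\sigma=[\sigma(1),\dots,\sigma(N)]$ and multiplied as functions, $(\sigma\tau)(i)=\sigma(\tau(i))$. Let $s_i=(i,i+1)$, and let $a_i=s_1s_{i+1}\in A_{n+1}$ for $1\le i\le n-1$. For $1\le j\le n-1$ put $$R^S_j=\{1,\,s_j,\,s_js_{j-1},\dots,s_j\cdots s_1\},\qquad R^A_j=\{1,\,a_j,\,a_ja_{j-1},\dots,a_j\cdots a_2,\,a_j\cdots a_2a_1,\,a_j\cdots a_2a_1^{-1}\}.$$ Every $w\in S_n$ has a unique presentation $w=w_1\cdots w_{n-1}$ with $w_j\in R^S_j$, and every $v\in A_{n+1}$ has a unique presentation $v=v_1\cdots v_{n-1}$ with $v_j\in R^A_j$ (the $S$- and the $A$-canonical presentation). *Statistics.* For $v\in A_{n+1}$ let $\ell_A(v)$ be the number of letters $a_i^{\pm1}$ in the $A$-canonical presentation of $v$, and let $$\mathrm{Des}_A(v)=\{1\le i\le n-1 : \ell_A(v)\ge \ell_A(va_i)\},\qquad \mathrm{rmaj}_{A_{n+1}}(v)=\sum_{i\in \mathrm{Des}_A(v)}(n-i),$$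 $$\mathrm{Del}_A(v)=\{2<j\le n+1 : v(i)<v(j)\text{ for at most one } i<j\},\qquad \mathrm{del}_A(v)=|\mathrm{Del}_A(v)|.$$ *The covering map and its local inverses.* The map $f:A_{n+1}\to S_n$ replaces every letter $a_i^{\pm1}$ in the $A$-canonical presentation of $v$ by $s_i$. For $u\in A_{n+1}$ with $A$-canonical presentation $u=u_1\cdots u_{n-1}$, the map $g_u:S_n\to A_{n+1}$ sends $w$, with $S$-canonical presentation $w_1\cdots w_{n-1}$, to $g_u(w_1)\cdots g_u(w_{n-1})$, where $g_u(s_j\cdots s_1)=u_j$, $g_u(s_j\cdots s_\ell)=a_j\cdots a_\ell$ for $2\le \ell\le j$, and $g_u(1)=1$. *The Foata bijection.* For a nonempty word $r$ over a totally ordered alphabet and a letter $x$: if the last letter of $r$ is $\le x$ (respectively $>x$), cut $r$ after every letter $\le x$ (respectively $>x$), and let $\gamma_x(r)$ be obtained by moving the last letter of each compartment to the beginning of that compartment. Put $\Phi(r)=r$ for a word $r$ of length at most $1$, and $\Phi(rx)=\gamma_x(\Phi(r))\,x$ for a nonempty word $r$ and a letter $x$. Since $\Phi$ rearranges the letters of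 a word, it acts on $S_n$. Let $\mathrm{rev}[\sigma_1,\dots,\sigma_n]=[\sigma_n,\dots,\sigma_1]$ and $\overleftarrow{\Phi}=\mathrm{rev}\,\Phi\,\mathrm{rev}$. **Theorem.** Define $\Psi:A_{n+1}\to A_{n+1}$ by $\Psi(v)=g_v(\overleftarrow{\Phi}(f(v)))$. Then: 1. $\Psi$ is a bijection of $A_{n+1}$ onto itself. 2. $\mathrm{rmaj}_{A_{n+1}}(v)=\ell_A(\Psi(v))$ for every $v\in A_{n+1}$. 3. $\mathrm{del}_A(v)=\mathrm{del}_A(\Psi(v))$ for every $v\in A_{n+1}$. 4. $\mathrm{Del}_A(v^{-1})=\mathrm{Del}_A(\Psi(v)^{-1})$ for every $v\in A_{n+1}$. 5. $\mathrm{Des}_A(v^{-1})=\mathrm{Des}_A(\Psi(v)^{-1})$ for every $v\in A_{n+1}$. 6. Consequently (the Regev–Roichman equidistribution theorem), for all finite sets $D_1,D_2$ of natural numbers, $$\sum_{\substack{v\in A_{n+1}\\ \mathrm{Des}_A(v^{-1})\subseteq D_1,\ \mathrm{Del}_A(v^{-1})\subseteq D_2}} q^{\mathrm{rmaj}_{A_{n+1}}(v)}=\sum_{\substack{v\in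 A_{n+1}\\ \mathrm{Des}_A(v^{-1})\subseteq D_1,\ \mathrm{Del}_A(v^{-1})\subseteq D_2}} q^{\ell_A(v)}$$ as polynomials in $q$. -/

import Mathlib

namespace AltFoata

open Finset

/-! ### Canonical presentations

Positions and letters `1, …, N` are realised by `Fin N`, the element `k` being `⟨k - 1, _⟩`.
Products of permutations are compositions of functions, so that right multiplication by `s_i`
swaps the letters in the positions `i` and `i + 1`. -/

/-- The Coxeter generator `s_i = (i, i+1)` of `S_N`, for `1 ≤ i ≤ N - 1`
(and the identity outside this range). -/
def s (N i : ℕ) : Equiv.Perm (Fin N) :=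
  if h : 1 ≤ i ∧ i < N then
    Equiv.swap ⟨i - 1, lt_of_le_of_lt (Nat.sub_le i 1) h.2⟩ ⟨i, h.2⟩
  else 1

theorem s_of {N i : ℕ} (h1 : 1 ≤ i) (h2 : i < N) :
    s N i = Equiv.swap ⟨i - 1, lt_of_le_of_lt (Nat.sub_le i 1) h2⟩ ⟨i, h2⟩ :=
  dif_pos ⟨h1, h2⟩

theorem sign_s {N i : ℕ} (h1 : 1 ≤ i) (h2 : i < N) : Equiv.Perm.sign (s N i) = -1 := by
  rw [s_of h1 h2]
  apply Equiv.Perm.sign_swap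
  intro h
  have := congrArg Fin.val h
  simp at this
  omega

/-- The generator `a_i = s_1 s_{i+1}` of `A_{n+1}`, for `1 ≤ i ≤ n - 1`
(and the identity outside this range). -/
def a (n i : ℕ) : alternatingGroup (Fin (n + 1)) :=
  if h : 1 ≤ i ∧ i < n then
    ⟨s (n + 1) 1 * s (n + 1) (i + 1), by
      rw [Equiv.Perm.mem_alternatingGroup, map_mul, sign_s (by omega) (by omega),
        sign_s (by omega) (by omega)]
      rfl⟩
  else 1

/-- The word `s_j s_{j-1} ⋯ s_l`, given by the list of its indices
(the empty word if `l = j + 1`). -/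
def sWord (j l : ℕ) : List ℕ := (List.range' l (j + 1 - l)).reverse

/-- `R^S_j = {1, s_j, s_j s_{j-1}, …, s_j ⋯ s_1}`, as a set of words. -/
def RS (j : ℕ) : Set (List ℕ) := {w | ∃ l, 1 ≤ l ∧ l ≤ j + 1 ∧ w = sWord j l}

/-- The word `a_j a_{j-1} ⋯ a_l`. A letter `(i, true)` stands for `a_i`, and a letter
`(i, false)` stands for `a_i⁻¹`. -/
def aWord (j l : ℕ) : List (ℕ × Bool) := (sWord j l).map fun i => (i, true)

/-- `R^A_j = {1, a_j, a_j a_{j-1}, …, a_j ⋯ a_2 a_1, a_j ⋯ a_2 a_1⁻¹}`, as a set of words. -/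
def RA (j : ℕ) : Set (List (ℕ × Bool)) :=
  {w | (∃ l, 1 ≤ l ∧ l ≤ j + 1 ∧ w = aWord j l) ∨ w = aWord j 2 ++ [(1, false)]}

/-- The element of `S_n` given by a word in the letters `s_i`. -/
def sEval (n : ℕ) (w : List ℕ) : Equiv.Perm (Fin n) := (w.map (s n)).prod

/-- The element of `A_{n+1}` given by a word in the letters `a_i`, `a_i⁻¹`. -/
def aEval (n : ℕ) (w : List (ℕ × Bool)) : alternatingGroup (Fin (n + 1)) :=
  (w.map fun x => if x.2 then a n x.1 else (a n x.1)⁻¹).prod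

/-- The product `w_1 w_2 ⋯ w_m` of the group elements given by the words `w_1, …, w_m`. -/
def factorProd {G β : Type*} [Group G] (ev : List β → G) (w : ℕ → List β) (m : ℕ) : G :=
  ((List.range' 1 m).map fun j => ev (w j)).prod

/-- `g = w_1 ⋯ w_m` with `w_j ∈ R_j` for `1 ≤ j ≤ m`. (A family of words `w_1, …, w_m` is
written as a function on `ℕ` whose remaining values are the empty word.) -/
structure IsCanonical {G β : Type*} [Group G] (R : ℕ → Set (List β)) (ev : List β → G) (m : ℕ)
    (g : G) (w : ℕ → List β) : Prop where
  mem : ∀ j, 1 ≤ j → j ≤ m → w j ∈ R j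
  nil : ∀ j, ¬ (1 ≤ j ∧ j ≤ m) → w j = []
  prod : factorProd ev w m = g

theorem factorProd_succ {G β : Type*} [Group G] (ev : List β → G) (w : ℕ → List β) (m : ℕ) :
    factorProd ev w (m + 1) = factorProd ev w m * ev (w (m + 1)) := by
  simp [factorProd, List.range'_1_concat, add_comm]

theorem factorProd_congr {G β : Type*} [Group G] (ev : List β → G) {w w' : ℕ → List β} {m : ℕ}
    (h : ∀ j, 1 ≤ j → j ≤ m → w j = w' j) : factorProd ev w m = factorProd ev w' m := by
  unfold factorProd
  congr 1
  apply List.map_congr_left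
  intro j hj
  rw [List.mem_range'_1] at hj
  rw [h j hj.1 (by omega)]

section General

variable {G β : Type*} [Group G] {N d M : ℕ} (φ : G →* Equiv.Perm (Fin N))
  (R : ℕ → Set (List β)) (ev : List β → G)

theorem factorProd_fix
    (hfix : ∀ j, 1 ≤ j → j ≤ M → ∀ w ∈ R j, ∀ x : Fin N, j + d < x.val → φ (ev w) x = x)
    (w : ℕ → List β) (m : ℕ) (hm : m ≤ M) (hw : ∀ j, 1 ≤ j → j ≤ m → w j ∈ R j)
    (x : Fin N) (hx : m + d < x.val) : φ (factorProd ev w m) x = x := by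
  induction m with
  | zero => simp [factorProd]
  | succ m ih =>
    rw [factorProd_succ, map_mul, Equiv.Perm.mul_apply,
      hfix (m + 1) (by omega) hm _ (hw _ (by omega) le_rfl) x hx]
    exact ih (by omega) (fun j h1 h2 => hw j h1 (by omega)) (by omega)

theorem exists_isCanonical
    (h0 : ∀ g, (∀ x : Fin N, d < x.val → φ g x = x) → g = 1)
    (hfix : ∀ j, 1 ≤ j → j ≤ M → ∀ w ∈ R j, ∀ x : Fin N, j + d < x.val → φ (ev w) x = x)
    (hex : ∀ j, 1 ≤ j → j ≤ M → ∀ p : Fin N, p.val ≤ j + d →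
      ∃ w ∈ R j, (φ (ev w) p).val = j + d)
    (m : ℕ) (hm : m ≤ M) (hmN : m + d < N ∨ m = 0) (g : G)
    (hg : ∀ x : Fin N, m + d < x.val → φ g x = x) : ∃ w, IsCanonical R ev m g w := by
  induction m generalizing g with
  | zero =>
    refine ⟨fun _ => [], ⟨fun j h1 h2 => by omega, fun _ _ => rfl, ?_⟩⟩
    rw [h0 g (by simpa using hg)]
    simp [factorProd]
  | succ m ih =>
    have hN : m + 1 + d < N := by omega
    set t : Fin N := ⟨m + 1 + d, hN⟩ with ht
    have hp : ((φ g)⁻¹ t).val ≤ m + 1 + d := by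
      by_contra hlt
      have h := hg ((φ g)⁻¹ t) (by omega)
      have h' : φ g ((φ g)⁻¹ t) = t := by simp
      rw [h'] at h
      rw [← h] at hlt
      simp [ht] at hlt
    obtain ⟨c, hc, hcp⟩ := hex (m + 1) (by omega) hm _ hp
    have hcp' : φ (ev c) ((φ g)⁻¹ t) = t := Fin.ext hcp
    have hg' : ∀ x : Fin N, m + d < x.val → φ (g * (ev c)⁻¹) x = x := by
      intro x hx
      rw [map_mul, map_inv, Equiv.Perm.mul_apply]
      by_cases hxt : x = t
      · subst hxt
        conv_lhs => rw [← hcp']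
        simp
      · have hx' : m + 1 + d < x.val := by
          have : x.val ≠ m + 1 + d := fun h => hxt (Fin.ext h)
          omega
        have h1 : (φ (ev c))⁻¹ x = x := by
          rw [Equiv.Perm.inv_eq_iff_eq, hfix (m + 1) (by omega) hm c hc x hx']
        rw [h1, hg x hx']
    obtain ⟨w, hw⟩ := ih (by omega) (by omega) _ hg'
    refine ⟨Function.update w (m + 1) c, ⟨?_, ?_, ?_⟩⟩
    · intro j h1 h2
      rcases Nat.lt_or_ge j (m + 1) with h | h
      · rw [Function.update_of_ne (by omega)]
        exact hw.mem j h1 (by omega)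
      · obtain rfl : j = m + 1 := by omega
        simpa using hc
    · intro j hj
      rw [Function.update_of_ne (by rintro rfl; exact hj ⟨by omega, le_rfl⟩)]
      exact hw.nil j (by omega)
    · rw [factorProd_succ, Function.update_self,
        factorProd_congr ev (w' := w) (fun j _ h2 => Function.update_of_ne (by omega) _ _),
        hw.prod]
      simp

theorem isCanonical_unique
    (hfix : ∀ j, 1 ≤ j → j ≤ M → ∀ w ∈ R j, ∀ x : Fin N, j + d < x.val → φ (ev w) x = x)
    (hpos : ∀ j, 1 ≤ j → j ≤ M → ∀ w ∈ R j, ∃ p : Fin N, (φ (ev w) p).val = j + d)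
    (huniq : ∀ j, 1 ≤ j → j ≤ M → ∀ w ∈ R j, ∀ w' ∈ R j, ∀ p : Fin N,
      (φ (ev w) p).val = j + d → (φ (ev w') p).val = j + d → w = w')
    (m : ℕ) (hm : m ≤ M) (w w' : ℕ → List β)
    (hw : ∀ j, 1 ≤ j → j ≤ m → w j ∈ R j) (hw' : ∀ j, 1 ≤ j → j ≤ m → w' j ∈ R j)
    (h : factorProd ev w m = factorProd ev w' m) :
    ∀ j, 1 ≤ j → j ≤ m → w j = w' j := by
  induction m with
  | zero => intro j h1 h2; omega
  | succ m ih =>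
    have key : ∀ u : ℕ → List β, (∀ j, 1 ≤ j → j ≤ m + 1 → u j ∈ R j) → ∀ p : Fin N,
        (φ (ev (u (m + 1))) p).val = m + 1 + d ↔
          (φ (factorProd ev u (m + 1)) p).val = m + 1 + d := by
      intro u hu p
      have hf := factorProd_fix φ R ev hfix u m (by omega) (fun j h1 h2 => hu j h1 (by omega))
      rw [factorProd_succ, map_mul, Equiv.Perm.mul_apply]
      constructor
      · intro hp
        rw [hf _ (by omega), hp]
      · intro hp
        have h2 := hf _ (by omega : m + d < (φ (factorProd ev u m)
          (φ (ev (u (m + 1))) p)).val)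
        have h3 := (φ (factorProd ev u m)).injective h2
        rw [← h3, hp]
    have htop : w (m + 1) = w' (m + 1) := by
      obtain ⟨p, hp⟩ := hpos (m + 1) (by omega) hm _ (hw _ (by omega) le_rfl)
      refine huniq (m + 1) (by omega) hm _ (hw _ (by omega) le_rfl) _
        (hw' _ (by omega) le_rfl) p hp ?_
      rw [key w' hw' p, ← h, ← key w hw p]
      exact hp
    rw [factorProd_succ, factorProd_succ, htop] at h
    have ih' := ih (by omega) (fun j h1 h2 => hw j h1 (by omega))
      (fun j h1 h2 => hw' j h1 (by omega)) (mul_right_cancel h)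
    intro j h1 h2
    rcases Nat.lt_or_ge j (m + 1) with h3 | h3
    · exact ih' j h1 (by omega)
    · obtain rfl : j = m + 1 := by omega
      exact htop

theorem existsUnique_isCanonical
    (h0 : ∀ g, (∀ x : Fin N, d < x.val → φ g x = x) → g = 1)
    (hfix : ∀ j, 1 ≤ j → j ≤ M → ∀ w ∈ R j, ∀ x : Fin N, j + d < x.val → φ (ev w) x = x)
    (hex : ∀ j, 1 ≤ j → j ≤ M → ∀ p : Fin N, p.val ≤ j + d →
      ∃ w ∈ R j, (φ (ev w) p).val = j + d)
    (hpos : ∀ j, 1 ≤ j → j ≤ M → ∀ w ∈ R j, ∃ p : Fin N, (φ (ev w) p).val = j + d)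
    (huniq : ∀ j, 1 ≤ j → j ≤ M → ∀ w ∈ R j, ∀ w' ∈ R j, ∀ p : Fin N,
      (φ (ev w) p).val = j + d → (φ (ev w') p).val = j + d → w = w')
    (hMN : M + d < N ∨ M = 0) (hN : N ≤ M + d + 1) (g : G) : ∃! w, IsCanonical R ev M g w := by
  obtain ⟨w, hw⟩ := exists_isCanonical φ R ev h0 hfix hex M le_rfl hMN g
    (fun x hx => by have := x.isLt; omega)
  refine ⟨w, hw, fun w' hw' => ?_⟩
  funext j
  by_cases hj : 1 ≤ j ∧ j ≤ M
  · exact isCanonical_unique φ R ev hfix hpos huniq M le_rfl w' w hw'.mem hw.mem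
      (hw'.prod.trans hw.prod.symm) j hj.1 hj.2
  · rw [hw'.nil j hj, hw.nil j hj]

end General

theorem s_apply_of_gt {N i : ℕ} (x : Fin N) (h : i < x.val) : s N i x = x := by
  unfold s
  split_ifs with h1
  · apply Equiv.swap_apply_of_ne_of_ne <;> intro h2 <;> rw [h2] at h <;> simp at h
    omega
  · rfl

theorem s_apply_of_lt {N i : ℕ} (x : Fin N) (h : x.val + 1 < i) : s N i x = x := by
  unfold s
  split_ifs with h1
  · apply Equiv.swap_apply_of_ne_of_ne <;> intro h2 <;> rw [h2] at h <;> simp at h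
    omega
  · rfl

theorem s_apply_self {N i : ℕ} (x : Fin N) (h : x.val + 1 = i) (hi : i < N) :
    (s N i x).val = i := by
  rw [s_of (by omega) hi]
  have : x = ⟨i - 1, by omega⟩ := Fin.ext (by simp; omega)
  rw [this, Equiv.swap_apply_left]

theorem sWord_self (j : ℕ) : sWord j (j + 1) = [] := by simp [sWord]

theorem sWord_succ {j l : ℕ} (h : l ≤ j) : sWord j l = sWord j (l + 1) ++ [l] := by
  unfold sWord
  have : j + 1 - l = (j + 1 - (l + 1)) + 1 := by omega
  rw [this, List.range'_succ, List.reverse_cons]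

theorem sEval_append (n : ℕ) (u v : List ℕ) : sEval n (u ++ v) = sEval n u * sEval n v := by
  simp [sEval]

theorem aEval_append (n : ℕ) (u v : List (ℕ × Bool)) :
    aEval n (u ++ v) = aEval n u * aEval n v := by
  simp [aEval]

theorem sEval_fix {n j l : ℕ} (hl : l ≤ j + 1) (x : Fin n) (hx : j < x.val) :
    sEval n (sWord j l) x = x := by
  induction hl using Nat.decreasingInduction with
  | self => simp [sWord_self, sEval]
  | of_succ l hl ih =>
    rw [sWord_succ (by omega), sEval_append, Equiv.Perm.mul_apply]
    simp only [sEval, List.map_cons, List.map_nil, List.prod_singleton] at ih ⊢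
    rw [s_apply_of_gt x (by omega), ih]

theorem sEval_top {n j l : ℕ} (hl : l ≤ j + 1) (hj : j < n) (x : Fin n) (hx : x.val + 1 = l) :
    (sEval n (sWord j l) x).val = j := by
  induction hl using Nat.decreasingInduction generalizing x with
  | self => simp [sWord_self, sEval]; omega
  | of_succ l hl ih =>
    rw [sWord_succ (by omega), sEval_append, Equiv.Perm.mul_apply]
    simp only [sEval, List.map_cons, List.map_nil, List.prod_singleton] at ih ⊢
    apply ih
    rw [s_apply_self x hx (by omega)]

/-- Every `w ∈ S_n` has a unique `S`-canonical presentation `w = w_1 ⋯ w_{n-1}`,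
`w_j ∈ R^S_j`. -/
theorem existsUnique_sCanonical (n : ℕ) (w : Equiv.Perm (Fin n)) :
    ∃! p : ℕ → List ℕ, IsCanonical RS (sEval n) (n - 1) w p := by
  refine existsUnique_isCanonical (d := 0) (MonoidHom.id _) RS (sEval n) ?_ ?_ ?_ ?_ ?_
    (by omega) (by omega) w
  · intro g hg
    ext x
    rcases Nat.eq_zero_or_pos x.val with h | h
    · by_contra hne
      have h1 : 0 < (g x).val := by
        rw [Nat.pos_iff_ne_zero, ← h]
        exact hne
      have := g.injective (hg (g x) h1)
      exact hne (by rw [this]; rfl)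
    · exact congrArg Fin.val (hg x h)
  · rintro j - - _ ⟨l, -, h2, rfl⟩ x hx
    exact sEval_fix h2 x hx
  · intro j h1 h2 p hp
    exact ⟨_, ⟨p.val + 1, by omega, by omega, rfl⟩, sEval_top (by omega) (by omega) p rfl⟩
  · rintro j h1 h2 _ ⟨l, h3, h4, rfl⟩
    exact ⟨⟨l - 1, by omega⟩, sEval_top h4 (by omega) _ (by simp; omega)⟩
  · rintro j h1 h2 _ ⟨l, h3, h4, rfl⟩ _ ⟨l', h5, h6, rfl⟩ p hp hp'
    have e1 := sEval_top (n := n) h4 (by omega) ⟨l - 1, by omega⟩ (by simp; omega)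
    have e2 := sEval_top (n := n) h6 (by omega) ⟨l' - 1, by omega⟩ (by simp; omega)
    have f1 := (sEval n (sWord j l)).injective (Fin.ext (hp.trans e1.symm))
    have f2 := (sEval n (sWord j l')).injective (Fin.ext (hp'.trans e2.symm))
    have := congrArg Fin.val (f1.symm.trans f2)
    simp at this
    congr 1
    omega

theorem a_apply {n i : ℕ} (h1 : 1 ≤ i) (h2 : i < n) (x : Fin (n + 1)) :
    (a n i).val x = s (n + 1) 1 (s (n + 1) (i + 1) x) := by
  unfold a
  rw [dif_pos ⟨h1, h2⟩]
  rfl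

theorem a_apply_of_gt {n i : ℕ} (x : Fin (n + 1)) (h : i + 1 < x.val) : (a n i).val x = x := by
  by_cases h1 : 1 ≤ i ∧ i < n
  · rw [a_apply h1.1 h1.2, s_apply_of_gt x h, s_apply_of_gt x (by omega)]
  · unfold a
    rw [dif_neg h1]
    rfl

theorem a_apply_self {n i : ℕ} (h1 : 1 ≤ i) (h2 : i < n) (x : Fin (n + 1)) (hx : x.val = i) :
    ((a n i).val x).val = i + 1 := by
  have h3 := s_apply_self (N := n + 1) (i := i + 1) x (by omega) (by omega)
  rw [a_apply h1 h2, s_apply_of_gt _ (by omega), h3]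

theorem a_one_inv_apply {n : ℕ} (h2 : 1 < n) (x : Fin (n + 1)) (hx : x.val = 0) :
    ((a n 1)⁻¹.val x).val = 2 := by
  have hy : (a n 1).val ⟨2, by omega⟩ = x := by
    rw [a_apply le_rfl h2, s_of (i := 1 + 1) (by omega) (by omega), s_of (by omega) (by omega)]
    have : (⟨2, by omega⟩ : Fin (n + 1)) = ⟨1 + 1, by omega⟩ := rfl
    rw [this, Equiv.swap_apply_right]
    have : (⟨1 + 1 - 1, by omega⟩ : Fin (n + 1)) = ⟨1, by omega⟩ := rfl
    rw [this, Equiv.swap_apply_right]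
    exact Fin.ext (by simp [hx])
  have : (a n 1)⁻¹.val x = ⟨2, by omega⟩ := by
    rw [← hy]
    simp
  rw [this]

theorem aEval_fix {n j l : ℕ} (hl : l ≤ j + 1) (x : Fin (n + 1)) (hx : j + 1 < x.val) :
    (aEval n (aWord j l)).val x = x := by
  induction hl using Nat.decreasingInduction with
  | self => simp [aWord, sWord_self, aEval]
  | of_succ l hl ih =>
    rw [aWord, sWord_succ (by omega), List.map_append, aEval_append, Subgroup.coe_mul,
      Equiv.Perm.mul_apply]
    have : (aEval n (List.map (fun i => (i, true)) [l])).val x = x := by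
      simp only [aEval, List.map_cons, List.map_nil, List.prod_singleton, if_true]
      exact a_apply_of_gt x (by omega)
    rw [this]
    exact ih

theorem aEval_top {n j l : ℕ} (h1 : 1 ≤ l) (hl : l ≤ j + 1) (hj : j < n) (x : Fin (n + 1))
    (hx : x.val = l) : ((aEval n (aWord j l)).val x).val = j + 1 := by
  induction hl using Nat.decreasingInduction generalizing x with
  | self => simp [aWord, sWord_self, aEval, hx]
  | of_succ l hl ih =>
    rw [aWord, sWord_succ (by omega), List.map_append, aEval_append, Subgroup.coe_mul,
      Equiv.Perm.mul_apply]
    apply ih (by omega)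
    simp only [aEval, List.map_cons, List.map_nil, List.prod_singleton, if_true]
    exact a_apply_self h1 (by omega) x hx

theorem aEval_inv_fix {n j : ℕ} (hj : 1 ≤ j) (x : Fin (n + 1)) (hx : j + 1 < x.val) :
    (aEval n (aWord j 2 ++ [(1, false)])).val x = x := by
  rw [aEval_append, Subgroup.coe_mul, Equiv.Perm.mul_apply]
  have : (aEval n [(1, false)]).val x = x := by
    simp only [aEval, List.map_cons, List.map_nil, List.prod_singleton, Bool.false_eq_true,
      if_false, Subgroup.coe_inv]
    rw [Equiv.Perm.inv_eq_iff_eq, a_apply_of_gt x (by omega)]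
  rw [this]
  exact aEval_fix (by omega) x hx

theorem aEval_inv_top {n j : ℕ} (hj : 1 ≤ j) (hn : j < n) (x : Fin (n + 1)) (hx : x.val = 0) :
    ((aEval n (aWord j 2 ++ [(1, false)])).val x).val = j + 1 := by
  rw [aEval_append, Subgroup.coe_mul, Equiv.Perm.mul_apply]
  apply aEval_top (by omega) (by omega) hn
  simp only [aEval, List.map_cons, List.map_nil, List.prod_singleton, Bool.false_eq_true,
    if_false]
  exact a_one_inv_apply (by omega) x hx

theorem even_eq_one {n : ℕ} (g : alternatingGroup (Fin (n + 1)))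
    (hg : ∀ x : Fin (n + 1), 1 < x.val → g.val x = x) : g = 1 := by
  rcases Nat.eq_zero_or_pos n with rfl | hn
  · exact Subtype.ext (Equiv.ext fun x => Fin.ext (by omega))
  by_contra hne
  have hlow : ∀ x : Fin (n + 1), x.val ≤ 1 → (g.val x).val ≤ 1 := by
    intro x hx
    by_contra h
    have := g.val.injective (hg (g.val x) (by omega))
    rw [this] at h
    exact h hx
  set x0 : Fin (n + 1) := ⟨0, by omega⟩ with hx0
  set x1 : Fin (n + 1) := ⟨1, by omega⟩ with hx1
  have h01 : x0 ≠ x1 := by simp [hx0, hx1]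
  have hcase : ∀ y : Fin (n + 1), y.val ≤ 1 → y = x0 ∨ y = x1 := by
    intro y hy
    rcases (by omega : y.val = 0 ∨ y.val = 1) with h | h
    · exact Or.inl (Fin.ext h)
    · exact Or.inr (Fin.ext h)
  have hs : g.val = Equiv.swap x0 x1 ∨ g.val = 1 := by
    have g0 := hcase _ (hlow x0 (by simp [hx0]))
    have g1 := hcase _ (hlow x1 (by simp [hx1]))
    have hinj : g.val x0 ≠ g.val x1 := fun h => h01 (g.val.injective h)
    rcases g0 with g0 | g0
    · right
      have g1' : g.val x1 = x1 := by
        rcases g1 with g1 | g1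
        · exact absurd (g0.trans g1.symm) hinj
        · exact g1
      ext x
      rcases Nat.lt_or_ge 1 x.val with h | h
      · rw [hg x h]; rfl
      · rcases hcase x h with rfl | rfl
        · rw [g0]; rfl
        · rw [g1']; rfl
    · left
      have g1' : g.val x1 = x0 := by
        rcases g1 with g1 | g1
        · exact g1
        · exact absurd (g0.trans g1.symm) hinj
      ext x
      rcases Nat.lt_or_ge 1 x.val with h | h
      · rw [hg x h, Equiv.swap_apply_of_ne_of_ne]
        · intro e; rw [e] at h; simp [hx0] at h
        · intro e; rw [e] at h; simp [hx1] at h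
      · rcases hcase x h with rfl | rfl
        · rw [g0, Equiv.swap_apply_left]
        · rw [g1', Equiv.swap_apply_right]
  rcases hs with h | h
  · have h2 := Equiv.Perm.mem_alternatingGroup.1 g.2
    rw [h, Equiv.Perm.sign_swap h01] at h2
    exact absurd h2 (by decide)
  · exact hne (Subtype.ext h)

/-- Every `v ∈ A_{n+1}` has a unique `A`-canonical presentation `v = v_1 ⋯ v_{n-1}`,
`v_j ∈ R^A_j`. -/
theorem existsUnique_aCanonical (n : ℕ) (v : alternatingGroup (Fin (n + 1))) :
    ∃! p : ℕ → List (ℕ × Bool), IsCanonical RA (aEval n) (n - 1) v p := by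
  have hall : ∀ j, 1 ≤ j → j ≤ n - 1 → ∀ w ∈ RA j, ∃ p : Fin (n + 1),
      ((aEval n w).val p).val = j + 1 ∧
        w = if p.val = 0 then aWord j 2 ++ [(1, false)] else aWord j p.val := by
    rintro j h1 h2 w (⟨l, h3, h4, rfl⟩ | rfl)
    · refine ⟨⟨l, by omega⟩, aEval_top h3 h4 (by omega) _ rfl, ?_⟩
      rw [if_neg (by simp; omega)]
    · exact ⟨⟨0, by omega⟩, aEval_inv_top h1 (by omega) _ rfl, by simp⟩
  refine existsUnique_isCanonical (d := 1) (alternatingGroup (Fin (n + 1))).subtype RA (aEval n)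
    even_eq_one ?_ ?_ ?_ ?_ (by omega) (by omega) v
  · rintro j h1 - _ (⟨l, -, h2, rfl⟩ | rfl) x hx
    · exact aEval_fix h2 x hx
    · exact aEval_inv_fix h1 x hx
  · intro j h1 h2 p hp
    rcases Nat.eq_zero_or_pos p.val with h | h
    · exact ⟨_, Or.inr rfl, aEval_inv_top h1 (by omega) p h⟩
    · exact ⟨_, Or.inl ⟨p.val, h, hp, rfl⟩, aEval_top h hp (by omega) p rfl⟩
  · intro j h1 h2 w hw
    obtain ⟨p, hp, -⟩ := hall j h1 h2 w hw
    exact ⟨p, hp⟩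
  · intro j h1 h2 w hw w' hw' p hp hp'
    obtain ⟨q, hq, e⟩ := hall j h1 h2 w hw
    obtain ⟨q', hq', e'⟩ := hall j h1 h2 w' hw'
    have f1 : p = q := (aEval n w).val.injective (Fin.ext (hp.trans hq.symm))
    have f2 : p = q' := (aEval n w').val.injective (Fin.ext (hp'.trans hq'.symm))
    rw [e, e', ← f1, ← f2]

/-- The factors `w_1, …, w_{n-1}` of the `S`-canonical presentation of `w ∈ S_n`. -/
noncomputable def sCanon {n : ℕ} (w : Equiv.Perm (Fin n)) : ℕ → List ℕ :=
  (existsUnique_sCanonical n w).choose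

/-- The factors `v_1, …, v_{n-1}` of the `A`-canonical presentation of `v ∈ A_{n+1}`. -/
noncomputable def aCanon {n : ℕ} (v : alternatingGroup (Fin (n + 1))) : ℕ → List (ℕ × Bool) :=
  (existsUnique_aCanonical n v).choose

theorem sCanon_spec {n : ℕ} (w : Equiv.Perm (Fin n)) :
    IsCanonical RS (sEval n) (n - 1) w (sCanon w) :=
  (existsUnique_sCanonical n w).choose_spec.1

theorem aCanon_spec {n : ℕ} (v : alternatingGroup (Fin (n + 1))) :
    IsCanonical RA (aEval n) (n - 1) v (aCanon v) :=
  (existsUnique_aCanonical n v).choose_spec.1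

/-! ### Statistics on `A_{n+1}` -/

/-- The `A`-length: the number of letters `a_i^{±1}` in the `A`-canonical presentation. -/
noncomputable def lenA {n : ℕ} (v : alternatingGroup (Fin (n + 1))) : ℕ :=
  ∑ j ∈ Icc 1 (n - 1), (aCanon v j).length

/-- The `A`-descent set `{1 ≤ i ≤ n - 1 | ℓ_A(v) ≥ ℓ_A(v a_i)}`. -/
noncomputable def DesA {n : ℕ} (v : alternatingGroup (Fin (n + 1))) : Finset ℕ :=
  {i ∈ Icc 1 (n - 1) | lenA v ≥ lenA (v * a n i)}

/-- The reverse `A_{n+1}` major index. -/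
noncomputable def rmajA {n : ℕ} (v : alternatingGroup (Fin (n + 1))) : ℕ :=
  ∑ i ∈ DesA v, (n - i)

/-- `Del_A(v)`: the positions `2 < j ≤ n + 1` for which there is at most one `i < j` with
`v(i) < v(j)`. (The element `j : Fin (n + 1)` is the position `j + 1`.) -/
def DelA {n : ℕ} (v : alternatingGroup (Fin (n + 1))) : Finset ℕ :=
  ({j : Fin (n + 1) | 2 < j.val + 1 ∧
    #{i : Fin (n + 1) | i < j ∧ v.val i < v.val j} ≤ 1} : Finset (Fin (n + 1))).image
      fun j => j.val + 1

/-- The delent number `del_A(v) = |Del_A(v)|`. -/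
def delA {n : ℕ} (v : alternatingGroup (Fin (n + 1))) : ℕ := #(DelA v)

/-! ### The Foata bijection -/

section Words

variable {X : Type*}

/-- Cut a word after every letter satisfying `p`. -/
def cutAfter (p : X → Bool) : List X → List (List X)
  | [] => []
  | y :: r =>
    if p y then [y] :: cutAfter p r
    else
      match cutAfter p r with
      | [] => [[y]]
      | b :: bs => (y :: b) :: bs

/-- Move the last letter of a word to its beginning. -/
def lastToFront (b : List X) : List X := b.getLast?.toList ++ b.dropLast

/-- The map `γ_x`: if the last letter of `r` is `≤ x` (respectively `> x`), cut `r` after every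
letter `≤ x` (respectively `> x`) and move the last letter of each compartment to the beginning
of the compartment. -/
def gammaMap [LinearOrder X] (x : X) (r : List X) : List X :=
  match r.getLast? with
  | none => []
  | some y =>
    ((cutAfter (if y ≤ x then fun z => decide (z ≤ x) else fun z => decide (x < z)) r).map
      lastToFront).flatten

/-- The second fundamental transformation of Foata on words: `Φ(x) = x` for a letter `x`, and
`Φ(r x) = γ_x(Φ(r)) x`. -/
def PhiWord [LinearOrder X] (r : List X) : List X :=
  r.foldl (fun t x => gammaMap x t ++ [x]) []

theorem cutAfter_flatten (p : X → Bool) (r : List X) : (cutAfter p r).flatten = r := by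
  induction r with
  | nil => rfl
  | cons y r ih =>
    rw [cutAfter]
    split_ifs
    · simp [ih]
    · split
      · next h => rw [h] at ih; simp at ih; simp [← ih]
      · next b bs h => rw [h] at ih; simp at ih; simp [← ih]

theorem lastToFront_perm (b : List X) : (lastToFront b).Perm b := by
  rcases List.eq_nil_or_concat b with rfl | ⟨c, y, rfl⟩
  · exact List.Perm.refl _
  · simp only [lastToFront, List.concat_eq_append, List.getLast?_append, List.getLast?_singleton,
      Option.some_or, Option.toList_some, List.dropLast_concat]
    exact List.perm_append_comm

theorem gammaMap_perm [LinearOrder X] (x : X) (r : List X) : (gammaMap x r).Perm r := by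
  unfold gammaMap
  split
  · next h => rw [List.getLast?_eq_none_iff] at h; rw [h]
  · next y h =>
    generalize (if y ≤ x then fun z => decide (z ≤ x) else fun z => decide (x < z)) = p
    conv_rhs => rw [← cutAfter_flatten p r]
    generalize cutAfter p r = L
    induction L with
    | nil => exact List.Perm.refl _
    | cons b L ih =>
      simp only [List.map_cons, List.flatten_cons]
      exact (lastToFront_perm b).append ih

theorem PhiWord_concat [LinearOrder X] (r : List X) (x : X) :
    PhiWord (r ++ [x]) = gammaMap x (PhiWord r) ++ [x] := by
  simp [PhiWord]

theorem PhiWord_perm [LinearOrder X] (r : List X) : (PhiWord r).Perm r := by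
  induction r using List.reverseRecOn with
  | nil => exact List.Perm.refl _
  | append_singleton r x ih =>
    rw [PhiWord_concat]
    exact ((gammaMap_perm x _).trans ih).append_right [x]

end Words

/-- The word `[σ(1), σ(2), …, σ(n)]` of a permutation. -/
def toWord {n : ℕ} (σ : Equiv.Perm (Fin n)) : List (Fin n) := List.ofFn σ

theorem toWord_nodup {n : ℕ} (σ : Equiv.Perm (Fin n)) : (toWord σ).Nodup :=
  List.nodup_ofFn.2 σ.injective

/-- The permutation whose word is a given rearrangement `r` of the word of a permutation `σ`. -/
noncomputable def ofWord {n : ℕ} (σ : Equiv.Perm (Fin n)) (r : List (Fin n)) (h : r.Perm (toWord σ)) :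
    Equiv.Perm (Fin n) :=
  Equiv.ofBijective (fun i => r.get (i.cast (by rw [h.length_eq]; simp [toWord])))
    (Finite.injective_iff_bijective.1 fun i j hij => by
      have := List.nodup_iff_injective_get.1 (h.nodup_iff.2 (toWord_nodup σ)) hij
      exact Fin.cast_injective _ this)

theorem toWord_ofWord {n : ℕ} (σ : Equiv.Perm (Fin n)) (r : List (Fin n))
    (h : r.Perm (toWord σ)) : toWord (ofWord σ r h) = r := by
  apply List.ext_get
  · rw [h.length_eq]; simp [toWord]
  · intro i h1 h2
    simp [toWord, ofWord]

/-- The Foata bijection `Φ : S_n → S_n`. -/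
noncomputable def Phi {n : ℕ} (σ : Equiv.Perm (Fin n)) : Equiv.Perm (Fin n) :=
  ofWord σ (PhiWord (toWord σ)) (PhiWord_perm _)

/-- The reverse `[σ(n), …, σ(1)]` of a permutation. -/
def rev {n : ℕ} (σ : Equiv.Perm (Fin n)) : Equiv.Perm (Fin n) := σ * Fin.revPerm

/-- The right-to-left Foata transformation `rev Φ rev`. -/
noncomputable def rtlPhi {n : ℕ} (σ : Equiv.Perm (Fin n)) : Equiv.Perm (Fin n) := rev (Phi (rev σ))

/-! ### The covering map, its local inverses, and the map `Ψ` -/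

/-- The covering map `f : A_{n+1} → S_n`: every letter `a_i^{±1}` in the `A`-canonical
presentation is replaced by `s_i`. -/
noncomputable def f {n : ℕ} (v : alternatingGroup (Fin (n + 1))) : Equiv.Perm (Fin n) :=
  factorProd (sEval n) (fun j => (aCanon v j).map Prod.fst) (n - 1)

/-- The map `g_u : S_n → A_{n+1}`: in the `S`-canonical presentation, a factor `s_j ⋯ s_1` is
replaced by the `j`-th factor `u_j` of the `A`-canonical presentation of `u`, and a factor
`s_j ⋯ s_l` with `l ≥ 2` is replaced by `a_j ⋯ a_l`. -/
noncomputable def g {n : ℕ} (u : alternatingGroup (Fin (n + 1))) (w : Equiv.Perm (Fin n)) :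
    alternatingGroup (Fin (n + 1)) :=
  factorProd (aEval n)
    (fun j => if sCanon w j = sWord j 1 then aCanon u j else (sCanon w j).map fun i => (i, true))
    (n - 1)

/-- The map `Ψ : A_{n+1} → A_{n+1}`. -/
noncomputable def Psi {n : ℕ} (v : alternatingGroup (Fin (n + 1))) :
    alternatingGroup (Fin (n + 1)) :=
  g v (rtlPhi (f v))

end AltFoata

/-! The covering map `f` reduces every assertion to classical facts about `S_n`. It has a
description free of canonical words. Let `rk σ i t` count the entries smaller than `t` among the
first `i` entries of `σ`. Then `f v` is the only permutation whose rank function is that of `v`,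
shifted by one in both arguments and diminished by one, negative values being cut off at zero
(`Covers`, `covers_f`). Inversion transposes rank functions, so `f` commutes with inversion.

Through `f` the statistics on `A_{n+1}` become ordinary ones: `lenA v` is the inversion number of `f
v` (`lenA_eq`), the `A`-descents of `v` are the descents of `f v` (`succ_mem_DesA`), and `DelA v⁻¹`
records the left-to-right minima of `f v`, as letters (`mem_DelA_inv`). On the side of `S_n`,
Foata's argument shows that `rtlPhi` turns the reverse major index into the inversion number
(`inversions_rtlPhi`), and keeps both the descents of the inverse and the set of left-to-right
minima.

The last property also makes `Psi` work. The `j`-th canonical factor of a permutation has as many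
letters as there are smaller letters to the right of the letter `j` (counted from 0). It is the full
word `s_j ⋯ s_1` exactly if that letter is a left-to-right minimum. So `f v` and `rtlPhi (f v)` have
full factors at the same places, and the choice between `a_1` and `a_1⁻¹`, which is all that `f`
forgets, can be carried over from `v`. Hence `f (Psi v) = rtlPhi (f v)`, and `Psi` is injective. -/

namespace AltFoata

open Finset

/-! ### Foata's transformation on words -/

section Words

variable {X : Type*}

/-- Cut a word after every letter satisfying `p` and rotate each compartment. -/
def rotate (p : X → Bool) (r : List X) : List X := ((cutAfter p r).map lastToFront).flatten

theorem cutAfter_ne_nil {p : X → Bool} {r b : List X} (hb : b ∈ cutAfter p r) : b ≠ [] := by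
  induction r generalizing b with
  | nil => simp [cutAfter] at hb
  | cons y r ih =>
    rw [cutAfter] at hb
    split_ifs at hb
    · rcases List.mem_cons.1 hb with rfl | h
      · simp
      · exact ih h
    · split at hb
      · simp at hb; simp [hb]
      · next c cs h =>
        rcases List.mem_cons.1 hb with rfl | h'
        · simp
        · exact ih (by rw [h]; exact List.mem_cons_of_mem _ h')

theorem rotate_nil (p : X → Bool) : rotate p [] = [] := rfl

theorem rotate_cons_of_pos {p : X → Bool} {y : X} (h : p y) (r : List X) :
    rotate p (y :: r) = y :: rotate p r := by
  simp [rotate, cutAfter, h, lastToFront]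

theorem lastToFront_cons_cons (y z : X) (b : List X) :
    ∃ x t, lastToFront (z :: b) = x :: t ∧ lastToFront (y :: z :: b) = x :: y :: t := by
  refine ⟨(z :: b).getLast (by simp), (z :: b).dropLast, ?_, ?_⟩ <;>
    simp [lastToFront, List.getLast?_eq_getLast_of_ne_nil]

/-- A letter not satisfying `p` that is put in front of a word is inserted by `rotate p` at
the second place. -/
theorem rotate_cons_of_neg {p : X → Bool} {y : X} (h : ¬ p y) {r : List X} (hr : r ≠ []) :
    ∃ z t, rotate p r = z :: t ∧ rotate p (y :: r) = z :: y :: t := by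
  unfold rotate
  rw [cutAfter, if_neg h]
  have hflat := cutAfter_flatten p r
  have hne := fun b => @cutAfter_ne_nil X p r b
  cases hc : cutAfter p r with
  | nil => rw [hc] at hflat; simp at hflat; exact absurd hflat hr
  | cons b bs =>
    rw [hc] at hne
    cases b with
    | nil => exact absurd rfl (hne [] (by simp))
    | cons z b =>
      obtain ⟨x, t, h1, h2⟩ := lastToFront_cons_cons y z b
      exact ⟨x, t ++ (bs.map lastToFront).flatten, by simp [h1], by simp [h2]⟩

/-- The last letter of the word exists and satisfies `p`. -/
def LastSat (p : X → Bool) (r : List X) : Prop := ∃ y ∈ r.getLast?, p y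

theorem lastSat_cons_cons {p : X → Bool} {y z : X} {r : List X} :
    LastSat p (y :: z :: r) ↔ LastSat p (z :: r) := by
  simp [LastSat, List.getLast?_cons_cons]

theorem LastSat.cons {p : X → Bool} {r : List X} (h : LastSat p r) (y : X) :
    LastSat p (y :: r) := by
  cases r with
  | nil => simp [LastSat] at h
  | cons z r => exact lastSat_cons_cons.2 h

/-- Induction on words from the left. A letter violating `p` opens no compartment of its own; its
case records where the rotation places it. -/
theorem rotate_induction {p : X → Bool} {motive : ∀ r, LastSat p r → Prop}
    (pos_single : ∀ y (h : p y), motive [y] ⟨y, rfl, h⟩)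
    (pos : ∀ y r, p y → ∀ hr : LastSat p r, motive r hr → motive (y :: r) (hr.cons y))
    (neg : ∀ y r z t, ¬ p y → ∀ hr : LastSat p r, rotate p r = z :: t →
      rotate p (y :: r) = z :: y :: t → motive r hr → motive (y :: r) (hr.cons y))
    (r : List X) (hr : LastSat p r) : motive r hr := by
  induction r with
  | nil => simp [LastSat] at hr
  | cons y r ih =>
    cases r with
    | nil => exact pos_single y (by simpa [LastSat] using hr)
    | cons z r =>
      rw [lastSat_cons_cons] at hr
      by_cases h : p y
      · exact pos y _ h hr (ih hr)
      · obtain ⟨x, t, h1, h2⟩ := rotate_cons_of_neg h (r := z :: r) (by simp)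
        exact neg y _ x t h hr h1 h2 (ih hr)

theorem rotate_head {p : X → Bool} {r : List X} (hr : LastSat p r) :
    ∃ z t, rotate p r = z :: t ∧ p z := by
  induction r, hr using rotate_induction with
  | pos_single y h => exact ⟨y, [], rotate_cons_of_pos h [], h⟩
  | pos y r h _ _ => exact ⟨y, _, rotate_cons_of_pos h r, h⟩
  | neg y r z t h _ h1 h2 ih =>
    obtain ⟨z', t', h3, h4⟩ := ih
    rw [h1] at h3
    cases h3
    exact ⟨z, _, h2, h4⟩

theorem rotate_perm (p : X → Bool) (r : List X) : (rotate p r).Perm r := by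
  unfold rotate
  conv_rhs => rw [← cutAfter_flatten p r]
  generalize cutAfter p r = L
  induction L with
  | nil => exact List.Perm.refl _
  | cons b L ih =>
    simp only [List.map_cons, List.flatten_cons]
    exact (lastToFront_perm b).append ih

/-- The second letter of the rotated word tells which case produced it. A leading letter satisfying
`p` is followed by the head of a rotated word, which satisfies `p` too; a leading letter violating
`p` is placed second itself. So letters can be peeled off one at a time. -/
theorem rotate_inj {p : X → Bool} {r r' : List X} (hr : LastSat p r) (hr' : LastSat p r')
    (h : rotate p r = rotate p r') : r = r' := by
  induction r, hr using rotate_induction generalizing r' with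
  | pos_single y hy =>
    have h1 := (rotate_perm p r').symm.trans (h ▸ rotate_perm p [y])
    exact (List.perm_singleton.1 h1).symm
  | pos y r hy hr ih =>
    cases r' with
    | nil => simp [LastSat] at hr'
    | cons y' r' =>
      rw [rotate_cons_of_pos hy] at h
      obtain ⟨z, t, hz, hpz⟩ := rotate_head hr
      cases r' with
      | nil =>
        have := (h ▸ rotate_perm p [y']).length_eq
        rw [List.length_cons, hz] at this
        simp at this
      | cons x' r' =>
        rw [lastSat_cons_cons] at hr'
        by_cases hy' : p y'
        · rw [rotate_cons_of_pos hy'] at h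
          injection h with h1 h2
          rw [h1, ih hr' h2]
        · obtain ⟨z', t', h1, h2⟩ := rotate_cons_of_neg hy' (r := x' :: r') (by simp)
          rw [h2, hz] at h
          injection h with h3 h4
          injection h4 with h5 h6
          exact absurd (h5 ▸ hpz) hy'
  | neg y r z t hy hr h1 h2 ih =>
    cases r' with
    | nil => simp [LastSat] at hr'
    | cons y' r' =>
      rw [h2] at h
      cases r' with
      | nil =>
        have := (h ▸ rotate_perm p [y']).length_eq
        simp at this
      | cons x' r' =>
        rw [lastSat_cons_cons] at hr'
        by_cases hy' : p y'
        · rw [rotate_cons_of_pos hy'] at h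
          injection h with h3 h4
          obtain ⟨z', t', h5, h6⟩ := rotate_head hr'
          rw [h5] at h4
          injection h4 with h7 h8
          exact absurd (h7 ▸ h6) hy
        · obtain ⟨z', t', h5, h6⟩ := rotate_cons_of_neg hy' (r := x' :: r') (by simp)
          rw [h6] at h
          injection h with h3 h4
          injection h4 with h7 h8
          rw [h7, ih hr' (by rw [h1, h5, h3, h8])]

/-- `rotate p` does not change the relative order of letters on which `p` is constant. -/
theorem filter_rotate {p : X → Bool} {r : List X} (hr : LastSat p r) (q : X → Bool)
    (hq : (∀ y, q y → p y) ∨ ∀ y, q y → ¬ p y) : (rotate p r).filter q = r.filter q := by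
  induction r, hr using rotate_induction with
  | pos_single y h => rw [rotate_cons_of_pos h]; rfl
  | pos y r h _ ih => rw [rotate_cons_of_pos h, List.filter_cons, List.filter_cons, ih]
  | neg y r z t h hr h1 h2 ih =>
    obtain ⟨z', t', h3, h4⟩ := rotate_head hr
    rw [h1] at h3
    cases h3
    rw [List.filter_cons (xs := r), ← ih, h1, h2]
    rcases hq with hq | hq
    · have : ¬ q y := fun h' => h (hq y h')
      simp [List.filter_cons, this]
    · have : ¬ q z := fun h' => hq z h' h4
      simp [List.filter_cons, this]

variable [LinearOrder X]

/-- The number of weak non-inversions of a word: pairs of positions `i < j` with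
`r_i ≤ r_j`. -/
def noninv : List X → ℕ
  | [] => 0
  | y :: r => r.countP (y ≤ ·) + noninv r

theorem noninv_concat (r : List X) (x : X) :
    noninv (r ++ [x]) = noninv r + r.countP (· ≤ x) := by
  induction r with
  | nil => simp [noninv]
  | cons y r ih =>
    simp only [List.cons_append, noninv, List.countP_append, List.countP_cons, ih,
      List.countP_nil]
    omega

theorem noninv_swap (y z : X) (t : List X) :
    noninv (z :: y :: t) + (if y ≤ z then 1 else 0) =
      noninv (y :: z :: t) + (if z ≤ y then 1 else 0) := by
  simp only [noninv, List.countP_cons, decide_eq_true_eq]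
  omega

/-- Each compartment consists of letters `> x` and one final letter `≤ x`. Moving the latter to the
front turns one inversion into a non-inversion for each letter `> x`. -/
theorem noninv_rotate_le {x : X} {r : List X} (hr : LastSat (fun z => decide (z ≤ x)) r) :
    noninv (rotate (fun z => decide (z ≤ x)) r) = noninv r + r.countP (x < ·) := by
  induction r, hr using rotate_induction with
  | pos_single y h =>
    rw [rotate_cons_of_pos (by exact h), rotate_nil]
    simp at h
    simp [noninv, h]
  | pos y r h _ ih =>
    rw [rotate_cons_of_pos (by exact h), noninv, ih, (rotate_perm _ r).countP_eq]
    simp at h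
    simp [noninv, h.not_gt]
    omega
  | neg y r z t h hr h1 h2 ih =>
    obtain ⟨z', t', h3, h4⟩ := rotate_head hr
    rw [h1] at h3
    cases h3
    simp at h h4
    -- Here `z ≤ x < y`, so placing `y` behind `z` instead of before it gains exactly one
    -- non-inversion.
    have h5 := noninv_swap y z t
    rw [if_neg (by order), if_pos (by order)] at h5
    rw [add_zero] at h5
    rw [h2, h5, ← h1, noninv, (rotate_perm _ r).countP_eq, ih]
    simp [noninv, h]
    omega

/-- The mirror case: one non-inversion is lost for each letter `≤ x`. The loss stands on the left to
avoid subtraction. -/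
theorem noninv_rotate_gt {x : X} {r : List X} (hr : LastSat (fun z => decide (x < z)) r) :
    noninv (rotate (fun z => decide (x < z)) r) + r.countP (· ≤ x) = noninv r := by
  induction r, hr using rotate_induction with
  | pos_single y h =>
    rw [rotate_cons_of_pos (by exact h), rotate_nil]
    simp at h
    simp [noninv, h]
  | pos y r h _ ih =>
    rw [rotate_cons_of_pos (by exact h), noninv, noninv, ← ih, (rotate_perm _ r).countP_eq]
    simp at h
    simp [h.not_ge]
    omega
  | neg y r z t h hr h1 h2 ih =>
    obtain ⟨z', t', h3, h4⟩ := rotate_head hr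
    rw [h1] at h3
    cases h3
    simp at h h4
    have h5 := noninv_swap y z t
    rw [if_pos (by order), if_neg (by order), ← h1, noninv.eq_2 y, (rotate_perm _ r).countP_eq] at h5
    rw [h2, noninv.eq_2 y, ← ih]
    simp [h]
    omega

theorem gammaMap_nil (x : X) : gammaMap x ([] : List X) = [] := rfl

/-- `γ_x` is a rotation with respect to `≤ x` or with respect to `> x`. -/
theorem gammaMap_cases (x : X) {r : List X} (hr : r ≠ []) :
    (LastSat (fun z => decide (z ≤ x)) r ∧
        gammaMap x r = rotate (fun z => decide (z ≤ x)) r) ∨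
      (LastSat (fun z => decide (x < z)) r ∧
        gammaMap x r = rotate (fun z => decide (x < z)) r) := by
  have h := List.getLast?_eq_some_getLast hr
  unfold gammaMap
  rw [h]
  by_cases hx : r.getLast hr ≤ x
  · exact Or.inl ⟨⟨_, h, by simpa using hx⟩, by simp [hx, rotate]⟩
  · exact Or.inr ⟨⟨_, h, by simpa using hx⟩, by simp [hx, rotate]⟩

/-- The head of the image lies on the same side of `x` as the last letter of the argument, so the
image reveals which of the two rotations was applied. -/
theorem gammaMap_injective (x : X) : Function.Injective (gammaMap (X := X) x) := by
  intro r r' h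
  have hp : r.Perm r' := (gammaMap_perm x r).symm.trans (h ▸ gammaMap_perm x r')
  by_cases hr : r = []
  · subst hr; exact (List.nil_perm.1 hp).symm
  have hr' : r' ≠ [] := by rintro rfl; exact hr (List.perm_nil.1 hp)
  rcases gammaMap_cases x hr with ⟨h1, h2⟩ | ⟨h1, h2⟩ <;>
    rcases gammaMap_cases x hr' with ⟨h3, h4⟩ | ⟨h3, h4⟩ <;> rw [h2, h4] at h
  · exact rotate_inj h1 h3 h
  · obtain ⟨z, t, h5, h6⟩ := rotate_head h1
    obtain ⟨z', t', h7, h8⟩ := rotate_head h3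
    rw [h5, h7] at h
    cases h
    simp at h6 h8
    order
  · obtain ⟨z, t, h5, h6⟩ := rotate_head h1
    obtain ⟨z', t', h7, h8⟩ := rotate_head h3
    rw [h5, h7] at h
    cases h
    simp at h6 h8
    order
  · exact rotate_inj h1 h3 h

theorem PhiWord_injective : Function.Injective (PhiWord (X := X)) := by
  intro r
  induction r using List.reverseRecOn with
  | nil =>
    intro r' h
    have := h ▸ PhiWord_perm r'
    exact (List.nil_perm.1 this).symm
  | append_singleton r x ih =>
    intro r' h
    rcases List.eq_nil_or_concat r' with rfl | ⟨r', x', rfl⟩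
    · exact List.perm_nil.1 ((PhiWord_perm _).symm.trans (h ▸ PhiWord_perm []))
    · rw [List.concat_eq_append, PhiWord_concat, PhiWord_concat] at h
      obtain ⟨h1, h2⟩ := List.append_inj' h rfl
      cases h2
      rw [ih (gammaMap_injective x h1), List.concat_eq_append]

/-- `γ_x` does not change the relative order of letters on the same side of `x`. -/
theorem filter_gammaMap (x : X) (r : List X) (q : X → Bool)
    (hq : (∀ y, q y → y ≤ x) ∨ ∀ y, q y → x < y) :
    (gammaMap x r).filter q = r.filter q := by
  by_cases hr : r = []
  · rw [hr, gammaMap_nil]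
  rcases gammaMap_cases x hr with ⟨h1, h2⟩ | ⟨h1, h2⟩ <;> rw [h2] <;> apply filter_rotate h1
  · simpa using hq
  · simpa using hq.symm

/-- `Φ` preserves the last letter among the letters `≤ k`. -/
theorem getLast?_filter_PhiWord (k : X) (r : List X) :
    ((PhiWord r).filter (· ≤ k)).getLast? = (r.filter (· ≤ k)).getLast? := by
  induction r using List.reverseRecOn with
  | nil => rfl
  | append_singleton r x ih =>
    rw [PhiWord_concat, List.filter_append, List.filter_append]
    by_cases hx : x ≤ k
    · simp [hx]
    -- All letters `≤ k` lie below `x`, so `γ_x` keeps their order.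
    · rw [filter_gammaMap x]
      · simp [hx, ih]
      · left; intro y hy; simp at hy; order

/-- `Φ` preserves the relative order of adjacent letters. -/
theorem filter_PhiWord {b c : X} (hbc : b ⋖ c) {r : List X} (hr : r.Nodup) :
    (PhiWord r).filter (fun y => y = b ∨ y = c) = r.filter (fun y => y = b ∨ y = c) := by
  induction r using List.reverseRecOn with
  | nil => rfl
  | append_singleton r x ih =>
    obtain ⟨h1, -, h2⟩ := List.nodup_append'.1 hr
    rw [PhiWord_concat, List.filter_append, List.filter_append]
    congr 1
    rw [← ih h1]
    have hxr : x ∉ r := fun h => h2 h (by simp)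
    rcases lt_or_ge x b with hx | hx
    · apply filter_gammaMap
      right
      intro y hy
      have := hbc.1
      simp at hy
      rcases hy with rfl | rfl <;> order
    · rcases hx.eq_or_lt with rfl | hx
      -- If `x = b`, this letter has not occurred before; only `c` can survive the filter, and it
      -- lies above `x`.
      · have h3 : ∀ t : List X, t.Perm r → t.filter (fun y => y = b ∨ y = c) =
            t.filter (fun y => y = c) := by
          intro t ht
          apply List.filter_congr
          intro y hy
          have : y ≠ b := by rintro rfl; exact hxr (ht.mem_iff.1 hy)
          simp [this]
        rw [h3 _ ((gammaMap_perm _ _).trans (PhiWord_perm _)), h3 _ (PhiWord_perm _)]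
        apply filter_gammaMap
        right
        intro y hy
        simp at hy
        rw [hy]
        exact hbc.1
      · have := hbc.ge_of_gt hx
        apply filter_gammaMap
        left
        intro y hy
        simp at hy
        rcases hy with rfl | rfl <;> order

theorem getLast?_PhiWord (r : List X) : (PhiWord r).getLast? = r.getLast? := by
  rcases List.eq_nil_or_concat r with rfl | ⟨r, x, rfl⟩
  · rfl
  · rw [List.concat_eq_append, PhiWord_concat]; simp

/-- The sum of `|w'|` over the suffixes `x w'` of the word such that the first letter of `w'`
is at most `x`. -/
def revMaj : List X → ℕ
  | [] => 0
  | x :: w => revMaj w + if ∃ y ∈ w.head?, y ≤ x then w.length else 0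

/-- Foata's count. Appending `x` adds one non-inversion for each earlier letter `≤ x`. If the
previous letter is `≤ x`, then `γ_x` gains one for each letter `> x`, and the total gain is the full
length; otherwise `γ_x` loses exactly what the new letter adds. -/
theorem noninv_PhiWord (w : List X) : noninv (PhiWord w.reverse) = revMaj w := by
  induction w with
  | nil => rfl
  | cons x w ih =>
    rw [List.reverse_cons, PhiWord_concat, noninv_concat, revMaj, ← ih,
      (gammaMap_perm _ _).countP_eq]
    by_cases hw : w = []
    · simp [hw, PhiWord, gammaMap_nil, noninv]
    have hlast : (PhiWord w.reverse).getLast? = w.head? := by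
      rw [getLast?_PhiWord, List.getLast?_reverse]
    have hne : PhiWord w.reverse ≠ [] := by
      intro h
      rw [h] at hlast
      cases w <;> simp at hlast hw
    have hlen := (PhiWord_perm w.reverse).length_eq
    rw [List.length_reverse] at hlen
    have hcount := List.length_eq_countP_add_countP (fun y => decide (y ≤ x))
      (l := PhiWord w.reverse)
    rcases gammaMap_cases x hne with ⟨h1, h2⟩ | ⟨h1, h2⟩
    · rw [h2, noninv_rotate_le h1, if_pos]
      · simp only [decide_eq_true_eq, not_le] at hcount
        omega
      · simpa [LastSat, hlast] using h1
    · rw [h2, if_neg, ← noninv_rotate_gt h1]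
      · rfl
      · rintro ⟨y, hy, hyx⟩
        obtain ⟨z, hz, hxz⟩ := h1
        rw [hlast] at hz
        cases Option.mem_unique hy hz
        simp at hxz
        order

end Words

/-! ### Rank functions of permutations -/

section Rank

variable {N : ℕ}

/-- The number of positions `j < i` with `σ(j) < t`. -/
def rk (σ : Equiv.Perm (Fin N)) (i t : ℕ) : ℕ := #{j : Fin N | j.val < i ∧ (σ j).val < t}

theorem rk_inv (σ : Equiv.Perm (Fin N)) (i t : ℕ) : rk σ⁻¹ i t = rk σ t i := by
  unfold rk
  refine card_bij (fun j _ => σ⁻¹ j) ?_ ?_ ?_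
  · intro j hj
    simp only [mem_filter, mem_univ, true_and] at hj ⊢
    exact ⟨hj.2, by simpa using hj.1⟩
  · intro j _ j' _ h
    exact σ⁻¹.injective h
  · intro j hj
    simp only [mem_filter, mem_univ, true_and] at hj
    exact ⟨σ j, by simpa using hj.symm, by simp⟩

theorem rk_zero_left (σ : Equiv.Perm (Fin N)) (t : ℕ) : rk σ 0 t = 0 := by simp [rk]

theorem rk_zero_right (σ : Equiv.Perm (Fin N)) (i : ℕ) : rk σ i 0 = 0 := by simp [rk]

theorem rk_succ (σ : Equiv.Perm (Fin N)) (x : Fin N) (t : ℕ) :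
    rk σ (x.val + 1) t = rk σ x.val t + if (σ x).val < t then 1 else 0 := by
  unfold rk
  have : ({j : Fin N | j.val < x.val + 1 ∧ (σ j).val < t} : Finset (Fin N)) =
      ({j : Fin N | j.val < x.val ∧ (σ j).val < t} : Finset (Fin N)) ∪
        if (σ x).val < t then {x} else ∅ := by
    ext j
    have hj : j = x ↔ j.val = x.val := Fin.ext_iff
    split_ifs with h
    · simp only [mem_filter, mem_univ, true_and, mem_union, mem_singleton]
      constructor
      · rintro ⟨h1, h2⟩
        rw [hj]
        omega
      · rintro (⟨h1, h2⟩ | rfl)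
        · exact ⟨by omega, h2⟩
        · exact ⟨by omega, h⟩
    · simp only [mem_filter, mem_univ, true_and, union_empty]
      constructor
      · rintro ⟨h1, h2⟩
        refine ⟨?_, h2⟩
        by_contra h3
        rw [hj.2 (by omega)] at h2
        exact h h2
      · rintro ⟨h1, h2⟩
        exact ⟨by omega, h2⟩
  rw [this, card_union_of_disjoint]
  · split_ifs <;> simp
  · split_ifs <;> simp

theorem rk_succ_of_le (σ : Equiv.Perm (Fin N)) {i : ℕ} (h : N ≤ i) (t : ℕ) :
    rk σ (i + 1) t = rk σ i t := by
  unfold rk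
  congr 1
  ext j
  have := j.isLt
  simp only [mem_filter, mem_univ, true_and]
  constructor <;> rintro ⟨h1, h2⟩ <;> exact ⟨by omega, h2⟩

theorem rk_le_succ (σ : Equiv.Perm (Fin N)) (i t : ℕ) : rk σ i t ≤ rk σ (i + 1) t := by
  rcases Nat.lt_or_ge i N with h | h
  · have := rk_succ σ ⟨i, h⟩ t
    simp only at this
    omega
  · rw [rk_succ_of_le σ h]

theorem rk_succ_le (σ : Equiv.Perm (Fin N)) (i t : ℕ) : rk σ (i + 1) t ≤ rk σ i t + 1 := by
  rcases Nat.lt_or_ge i N with h | h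
  · have := rk_succ σ ⟨i, h⟩ t
    simp only at this
    split_ifs at this <;> omega
  · rw [rk_succ_of_le σ h]; omega

theorem rk_mono_left (σ : Equiv.Perm (Fin N)) (t : ℕ) : Monotone fun i => rk σ i t :=
  monotone_nat_of_le_succ fun i => rk_le_succ σ i t

theorem rk_mono_right (σ : Equiv.Perm (Fin N)) (i : ℕ) : Monotone fun t => rk σ i t := by
  simp only [← rk_inv σ]
  exact rk_mono_left σ⁻¹ i

theorem rk_succ_right_le (σ : Equiv.Perm (Fin N)) (i t : ℕ) :
    rk σ i (t + 1) ≤ rk σ i t + 1 := by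
  rw [← rk_inv σ, ← rk_inv σ]
  exact rk_succ_le _ _ _

theorem rk_top (σ : Equiv.Perm (Fin N)) {i : ℕ} (hi : i ≤ N) : rk σ i N = i := by
  induction i with
  | zero => exact rk_zero_left σ N
  | succ i ih =>
    rw [rk_succ σ ⟨i, hi⟩, ih (by omega), if_pos (Fin.isLt _)]

theorem rk_one (i t : ℕ) : rk (1 : Equiv.Perm (Fin N)) i t = min (min i t) N := by
  induction i with
  | zero => simp [rk_zero_left]
  | succ i ih =>
    rcases Nat.lt_or_ge i N with h | h
    · have := rk_succ (1 : Equiv.Perm (Fin N)) ⟨i, h⟩ t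
      rcases Nat.lt_or_ge i t with h' | h'
      · rw [if_pos (by exact h')] at this
        simp only [ih] at this
        omega
      · rw [if_neg (by exact h'.not_gt)] at this
        simp only [ih] at this
        omega
    · rw [rk_succ_of_le _ h, ih]
      omega

theorem rk_injective {σ τ : Equiv.Perm (Fin N)} (h : ∀ i t, rk σ i t = rk τ i t) : σ = τ := by
  ext x
  have key : ∀ t, (σ x).val < t ↔ (τ x).val < t := by
    intro t
    have h1 := rk_succ σ x t
    have h2 := rk_succ τ x t
    rw [h, h, h2] at h1
    split_ifs at h1 <;> omega
  have h1 := key ((σ x).val + 1)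
  have h2 := key ((τ x).val + 1)
  omega

theorem s_val {i : ℕ} (h1 : 1 ≤ i) (h2 : i < N) (x : Fin N) :
    (s N i x).val = if x.val + 1 = i then i else if x.val = i then i - 1 else x.val := by
  rw [s_of h1 h2, Equiv.swap_apply_def]
  simp only [Fin.ext_iff]
  have : x.val = i - 1 ↔ x.val + 1 = i := by omega
  simp only [this]
  split_ifs <;> rfl

theorem s_mul_self (N i : ℕ) : s N i * s N i = 1 := by
  unfold s
  split_ifs
  · exact Equiv.swap_mul_self _ _
  · rfl

theorem s_inv (N i : ℕ) : (s N i)⁻¹ = s N i := inv_eq_of_mul_eq_one_left (s_mul_self N i)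

theorem s_apply_right {i : ℕ} (h2 : i + 1 < N) :
    s N (i + 1) ⟨i + 1, h2⟩ = ⟨i, by omega⟩ := by
  ext; rw [s_val (by omega) h2]; simp

theorem s_apply_left {i : ℕ} (h2 : i + 1 < N) :
    s N (i + 1) ⟨i, by omega⟩ = ⟨i + 1, h2⟩ := by
  ext; rw [s_val (by omega) h2]; simp

theorem rk_mul_s_of_ne (σ : Equiv.Perm (Fin N)) {i k : ℕ} (h1 : 1 ≤ i) (h2 : i < N)
    (hk : k ≠ i) (t : ℕ) : rk (σ * s N i) k t = rk σ k t := by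
  unfold rk
  refine card_bij (fun j _ => s N i j) ?_ ?_ ?_
  · intro j hj
    rw [mem_filter_univ] at hj ⊢
    refine ⟨?_, hj.2⟩
    rw [s_val h1 h2]
    split_ifs <;> omega
  · intro j _ j' _ h
    exact (s N i).injective h
  · intro j hj
    rw [mem_filter_univ] at hj
    have h3 : s N i (s N i j) = j := by
      rw [← Equiv.Perm.mul_apply, s_mul_self]; rfl
    refine ⟨s N i j, ?_, h3⟩
    rw [mem_filter_univ, Equiv.Perm.mul_apply, h3]
    refine ⟨?_, hj.2⟩
    rw [s_val h1 h2]
    split_ifs <;> omega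

/-- The new row `i + 1` adds to row `i` the entry that formerly came second, so old and new row `i +
1` together count what rows `i` and `i + 2` count. -/
theorem rk_mul_s_self (σ : Equiv.Perm (Fin N)) {i : ℕ} (h2 : i + 1 < N) (t : ℕ) :
    rk (σ * s N (i + 1)) (i + 1) t + rk σ (i + 1) t = rk σ i t + rk σ (i + 2) t := by
  have e1 := rk_succ (σ * s N (i + 1)) ⟨i, by omega⟩ t
  have e2 := rk_succ σ ⟨i + 1, h2⟩ t
  simp only [Equiv.Perm.mul_apply, s_apply_left h2] at e1 e2
  rw [rk_mul_s_of_ne σ (k := i) (by omega) h2 (by omega)] at e1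
  simp only [add_assoc, Nat.reduceAdd] at *
  omega

end Rank

/-- The relation between the rank functions of `σ ∈ S_{n+1}` and of the permutation in `S_n`
covered by it. -/
def Covers {n : ℕ} (σ : Equiv.Perm (Fin (n + 1))) (w : Equiv.Perm (Fin n)) : Prop :=
  ∀ i t, rk w i t = rk σ (i + 1) (t + 1) - 1

/-! ### The covering relation under multiplication by generators -/

section Covers

variable {n : ℕ} {σ : Equiv.Perm (Fin (n + 1))} {w : Equiv.Perm (Fin n)}

theorem Covers.unique {w' : Equiv.Perm (Fin n)} (h : Covers σ w) (h' : Covers σ w') : w = w' :=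
  rk_injective fun i t => (h i t).trans (h' i t).symm

theorem Covers.inv (h : Covers σ w) : Covers σ⁻¹ w⁻¹ := by
  intro i t
  rw [rk_inv, rk_inv, h]

theorem covers_one : Covers (1 : Equiv.Perm (Fin (n + 1))) (1 : Equiv.Perm (Fin n)) := by
  intro i t
  rw [rk_one, rk_one]
  omega

/-- Only row 1 of the rank function changes. Its entries are at most 1, so they vanish after the
truncated subtraction. -/
theorem Covers.mul_s_one (h : Covers σ w) : Covers (σ * s (n + 1) 1) w := by
  intro i t
  rcases Nat.eq_zero_or_pos n with rfl | hn
  · simpa [s] using h i t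
  rw [h]
  by_cases hi : i = 0
  · subst hi
    have h1 := rk_succ_le σ 0 (t + 1)
    have h2 := rk_succ_le (σ * s (n + 1) 1) 0 (t + 1)
    rw [rk_zero_left] at h1 h2
    omega
  · rw [rk_mul_s_of_ne σ le_rfl (by omega) (by omega)]

/-- Adjacent rows differ by 0 or 1. Truncated subtraction of 1 is compatible with the exchange rule
`rk_mul_s_self` for all such triples of rows except `(0, 1, 2)`. -/
theorem Covers.mul_s (h : Covers σ w) {i : ℕ} (hi : i + 1 < n)
    (hgood : ∀ t, ¬ (rk σ (i + 1) t = 0 ∧ rk σ (i + 2) t = 1 ∧ rk σ (i + 3) t = 2)) :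
    Covers (σ * s (n + 1) (i + 2)) (w * s n (i + 1)) := by
  intro k t
  by_cases hk : k = i + 1
  · subst hk
    have h1 := rk_mul_s_self w hi t
    have h2 := rk_mul_s_self σ (i := i + 1) (by omega) (t + 1)
    have h3 := hgood (t + 1)
    have h4 := rk_le_succ σ (i + 1) (t + 1)
    have h5 := rk_le_succ σ (i + 2) (t + 1)
    have h6 := rk_succ_le σ (i + 1) (t + 1)
    have h7 := rk_succ_le σ (i + 2) (t + 1)
    rw [h, h, h] at h1
    simp only [add_assoc, Nat.reduceAdd] at *
    omega
  · rw [rk_mul_s_of_ne w (by omega) hi hk, rk_mul_s_of_ne σ (by omega) (by omega) (by omega), h]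

/-- In the exceptional case the two exchanged entries of `σ` are smaller than everything before
them. Their order is lost in the truncation, while `w` inherits a descent. -/
theorem Covers.mul_s_of_bad (h : Covers σ w) {i : ℕ} (hi : i + 1 < n) {t₀ : ℕ}
    (hbad : rk σ (i + 1) t₀ = 0 ∧ rk σ (i + 2) t₀ = 1 ∧ rk σ (i + 3) t₀ = 2) :
    Covers (σ * s (n + 1) (i + 2)) w ∧ w ⟨i + 1, hi⟩ < w ⟨i, by omega⟩ := by
  obtain ⟨b1, b2, b3⟩ := hbad
  constructor
  · intro k t
    by_cases hk : k = i + 1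
    · subst hk
      have h2 := rk_mul_s_self σ (i := i + 1) (by omega) (t + 1)
      have h4 := rk_succ σ ⟨i + 1, by omega⟩ (t + 1)
      have h5 := rk_succ σ ⟨i + 2, by omega⟩ (t + 1)
      have h6 := rk_succ σ ⟨i + 1, by omega⟩ t₀
      have h7 := rk_succ σ ⟨i + 2, by omega⟩ t₀
      rw [h]
      simp only [add_assoc, Nat.reduceAdd] at *
      -- Up to column `t₀` the three rows are at most `0, 1, 2`, and truncation hides the exchange.
      -- Beyond it both exchanged entries are counted, so the middle row is unchanged.
      rcases Nat.lt_or_ge t t₀ with ht | ht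
      · have h8 := rk_mono_right σ (i + 1) ht
        have h9 := rk_mono_right σ (i + 3) ht
        simp only [Nat.succ_eq_add_one] at h8 h9
        split_ifs at * <;> omega
      · split_ifs at * <;> omega
    · rw [rk_mul_s_of_ne σ (by omega) (by omega) (by omega), h]
  · have ht : t₀ ≠ 0 := by
      rintro rfl
      rw [rk_zero_right] at b2
      omega
    obtain ⟨t, rfl⟩ := Nat.exists_eq_succ_of_ne_zero ht
    have h1 := rk_succ w ⟨i, by omega⟩ t
    have h2 := rk_succ w ⟨i + 1, hi⟩ t
    simp only [h _ t, add_assoc, Nat.reduceAdd, Nat.succ_eq_add_one] at *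
    rw [b1, b2] at h1
    rw [b2, b3] at h2
    rw [Fin.lt_def]
    split_ifs at * <;> omega

/-- Multiplication by `s_{i+2}` covers multiplication by `s_{i+1}`, or it does not change the
covered permutation, which has a descent. -/
theorem Covers.mul_s_cases (h : Covers σ w) {i : ℕ} (hi : i + 1 < n) :
    Covers (σ * s (n + 1) (i + 2)) (w * s n (i + 1)) ∨
      Covers (σ * s (n + 1) (i + 2)) w ∧ w ⟨i + 1, hi⟩ < w ⟨i, by omega⟩ := by
  by_cases hgood : ∀ t, ¬ (rk σ (i + 1) t = 0 ∧ rk σ (i + 2) t = 1 ∧ rk σ (i + 3) t = 2)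
  · exact Or.inl (h.mul_s hi hgood)
  · push Not at hgood
    obtain ⟨t, ht⟩ := hgood
    exact Or.inr (h.mul_s_of_bad hi ht)

/-- The exceptional case would put the entry `j` below `t` while all entries before it by at least
two places are `≥ t`. But `σ` maps 0 to a value at most `j`. -/
theorem Covers.mul_s_of_top (h : Covers σ w) {i j : ℕ} (hi : i + 1 < n)
    (htop : (σ ⟨i + 2, by omega⟩).val = j) (hfix : ∀ x, j < x.val → σ x = x) :
    Covers (σ * s (n + 1) (i + 2)) (w * s n (i + 1)) := by
  apply h.mul_s hi
  rintro t ⟨h1, h2, h3⟩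
  have h4 := rk_succ σ ⟨i + 2, by omega⟩ t
  simp only [add_assoc, Nat.reduceAdd, htop] at h4
  have h5 : (σ 0).val ≤ j := by
    by_contra h6
    have h7 := σ.injective (hfix (σ 0) (by omega))
    rw [h7] at h6
    simp at h6
  have h6 := rk_succ σ 0 t
  have h7 := rk_mono_left σ t (show 1 ≤ i + 1 by omega)
  simp only [Fin.val_zero, zero_add] at h6 h7
  split_ifs at * <;> omega

/-- The number of earlier smaller letters is at most `1` in `σ` exactly if it vanishes in the
permutation covered by `σ`. -/
theorem Covers.rk_le_one_iff (h : Covers σ w) {j : ℕ} (hj : j < n) :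
    rk σ (j + 1) (σ ⟨j + 1, by omega⟩) ≤ 1 ↔ rk w j (w ⟨j, hj⟩) = 0 := by
  constructor
  · intro h1
    have h2 : ∃ t, 1 ≤ rk σ (j + 1) t := ⟨n + 1, by rw [rk_top σ (by omega)]; omega⟩
    -- The rank grows with `t` in steps of at most 1, so it takes the value 1 beyond the entry at `j
    -- + 1`: right after that entry if the rank is already 1 there, otherwise at the first column
    -- where it is positive.
    obtain ⟨t, ht, hmin⟩ : ∃ t, rk σ (j + 1) t = 1 ∧ (σ ⟨j + 1, by omega⟩).val < t := by
      by_cases h3 : rk σ (j + 1) (σ ⟨j + 1, by omega⟩) = 1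
      · refine ⟨(σ ⟨j + 1, by omega⟩).val + 1, ?_, by omega⟩
        have h4 := rk_succ σ⁻¹ (σ ⟨j + 1, by omega⟩) (j + 1)
        rw [rk_inv, rk_inv, h3] at h4
        simpa using h4
      · classical
        refine ⟨Nat.find h2, ?_, ?_⟩
        · have h4 := Nat.find_spec h2
          have h5 : Nat.find h2 ≠ 0 := by
            intro h6
            rw [h6, rk_zero_right] at h4
            omega
          have h6 := Nat.find_min h2 (m := Nat.find h2 - 1) (by omega)
          have h7 := rk_succ_right_le σ (j + 1) (Nat.find h2 - 1)
          rw [Nat.sub_add_cancel (by omega)] at h7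
          omega
        · by_contra h6
          have h7 := rk_mono_right σ (j + 1) (not_lt.1 h6)
          have := Nat.find_spec h2
          simp only at h7
          omega
    have h3 := rk_succ σ ⟨j + 1, by omega⟩ t
    obtain ⟨t, rfl⟩ := Nat.exists_eq_succ_of_ne_zero (show t ≠ 0 by omega)
    have h4 := rk_succ w ⟨j, hj⟩ t
    simp only [h _ t, Nat.succ_eq_add_one] at *
    rw [if_pos hmin, ht] at h3
    rw [h3, ht] at h4
    have h5 : (w ⟨j, hj⟩).val < t := by
      by_contra h6
      rw [if_neg h6] at h4
      omega
    have h6 := rk_mono_right w j h5.le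
    simp only [h _ t] at h6
    omega
  · intro h1
    have h2 := rk_succ w ⟨j, hj⟩ ((w ⟨j, hj⟩).val + 1)
    have h3 := rk_succ w⁻¹ (w ⟨j, hj⟩) j
    rw [rk_inv, rk_inv, h1] at h3
    simp at h3
    simp only [h3, lt_add_iff_pos_right, zero_lt_one, if_true] at h2
    rw [h] at h2 h3
    have h4 := rk_succ σ ⟨j + 1, by omega⟩ ((w ⟨j, hj⟩).val + 1 + 1)
    simp only at h4
    have h5 : (σ ⟨j + 1, by omega⟩).val < (w ⟨j, hj⟩).val + 1 + 1 := by
      by_contra h6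
      rw [if_neg h6] at h4
      omega
    have h6 := rk_mono_right σ (j + 1) h5.le
    simp only at h6
    omega

end Covers

/-! ### The covering map through rank functions -/

section Covering

variable {n : ℕ}

theorem a_val {i : ℕ} (h1 : 1 ≤ i) (h2 : i < n) :
    (a n i).val = s (n + 1) 1 * s (n + 1) (i + 1) :=
  Equiv.ext fun x => a_apply h1 h2 x

theorem map_fst_aWord (j l : ℕ) : (aWord j l).map Prod.fst = sWord j l := by
  simp [aWord, Function.comp_def]

theorem map_fst_aWord_inv {j : ℕ} (hj : 1 ≤ j) :
    (aWord j 2 ++ [(1, false)]).map Prod.fst = sWord j 1 := by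
  rw [List.map_append, map_fst_aWord, sWord_succ hj]
  rfl

theorem map_fst_mem_RS {j : ℕ} (hj : 1 ≤ j) {u : List (ℕ × Bool)} (hu : u ∈ RA j) :
    u.map Prod.fst ∈ RS j := by
  rcases hu with ⟨l, h1, h2, rfl⟩ | rfl
  · exact ⟨l, h1, h2, map_fst_aWord j l⟩
  · exact ⟨1, le_rfl, by omega, map_fst_aWord_inv hj⟩

theorem RA_fix {j : ℕ} (hj : 1 ≤ j) {u : List (ℕ × Bool)} (hu : u ∈ RA j) (x : Fin (n + 1))
    (hx : j + 1 < x.val) : (aEval n u).val x = x := by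
  rcases hu with ⟨l, -, h2, rfl⟩ | rfl
  · exact aEval_fix h2 x hx
  · exact aEval_inv_fix hj x hx

/-- Write `a_l = s_1 s_{l+1}`. The factor `s_1` is invisible, and before `s_{l+1}` is applied the
largest moved value `j + 1` sits at the right one of the two exchanged places, which excludes the
exceptional case. -/
theorem Covers.mul_aWord {P : alternatingGroup (Fin (n + 1))} {Q : Equiv.Perm (Fin n)}
    (h : Covers P.val Q) {j : ℕ} (hj : j < n) (hfix : ∀ x : Fin (n + 1), j < x.val → P.val x = x)
    {l : ℕ} (hl : l ≤ j + 1) (h1 : 1 ≤ l) :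
    Covers (P * aEval n (aWord j l)).val (Q * sEval n (sWord j l)) := by
  induction hl using Nat.decreasingInduction with
  | self => simpa [aWord, sWord_self, aEval, sEval] using h
  | of_succ l hl ih =>
    obtain ⟨i, rfl⟩ : ∃ i, l = i + 1 := ⟨l - 1, by omega⟩
    have key := ((ih (by omega)).mul_s_one).mul_s_of_top (i := i) (j := j + 1) (by omega) ?_ ?_
    · rw [aWord, sWord_succ (by omega), List.map_append, aEval_append, sEval_append]
      simp only [aEval, sEval, List.map_cons, List.map_nil, List.prod_singleton, if_true,
        Subgroup.coe_mul, a_val h1 (show i + 1 < n by omega)] at key ⊢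
      simpa only [mul_assoc, aWord] using key
    · have e1 : s (n + 1) 1 ⟨i + 2, by omega⟩ = ⟨i + 2, by omega⟩ :=
        s_apply_of_gt _ (by simp)
      have e2 := aEval_top (n := n) (j := j) (l := i + 1 + 1) (by omega) (by omega) hj
        ⟨i + 2, by omega⟩ rfl
      rw [Equiv.Perm.mul_apply, e1, Subgroup.coe_mul, Equiv.Perm.mul_apply, hfix _ (by omega)]
      exact e2
    · intro x hx
      rw [Equiv.Perm.mul_apply, s_apply_of_gt x (by omega), Subgroup.coe_mul,
        Equiv.Perm.mul_apply, aEval_fix (by omega) x hx, hfix x (by omega)]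

/-- The only new word ends in `a_1⁻¹ = s_2 s_1`; it differs from `a_1` by the position of the
invisible `s_1`, so it covers `s_1` as well. -/
theorem Covers.mul_RA {P : alternatingGroup (Fin (n + 1))} {Q : Equiv.Perm (Fin n)}
    (h : Covers P.val Q) {j : ℕ} (h1 : 1 ≤ j) (hj : j < n)
    (hfix : ∀ x : Fin (n + 1), j < x.val → P.val x = x) {u : List (ℕ × Bool)} (hu : u ∈ RA j) :
    Covers (P * aEval n u).val (Q * sEval n (u.map Prod.fst)) := by
  rcases hu with ⟨l, h2, h3, rfl⟩ | rfl
  · rw [map_fst_aWord]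
    exact h.mul_aWord hj hfix h3 h2
  · have key := ((h.mul_aWord hj hfix (l := 2) (by omega) (by omega)).mul_s_of_top
      (i := 0) (j := j + 1) (by omega) ?_ ?_).mul_s_one
    · rw [map_fst_aWord_inv h1, sWord_succ h1, aEval_append, sEval_append]
      simp only [aEval, sEval, List.map_cons, List.map_nil, List.prod_singleton,
        Subgroup.coe_mul, Subgroup.coe_inv, a_val (n := n) le_rfl (show 1 < n by omega),
        mul_inv_rev, s_inv, Bool.false_eq_true, if_false] at key ⊢
      simpa only [mul_assoc] using key
    · have e2 := aEval_top (n := n) (j := j) (l := 2) (by omega) (by omega) hj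
        ⟨2, by omega⟩ rfl
      rw [Subgroup.coe_mul, Equiv.Perm.mul_apply, hfix _ (by simp only [zero_add]; omega)]
      exact e2
    · intro x hx
      rw [Subgroup.coe_mul, Equiv.Perm.mul_apply, aEval_fix (by omega) x hx, hfix x (by omega)]

theorem covers_factorProd {p : ℕ → List (ℕ × Bool)} {m : ℕ} (hm : m ≤ n - 1)
    (hp : ∀ j, 1 ≤ j → j ≤ m → p j ∈ RA j) :
    Covers (factorProd (aEval n) p m).val
      (factorProd (sEval n) (fun j => (p j).map Prod.fst) m) := by
  induction m with
  | zero => simpa [factorProd] using covers_one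
  | succ m ih =>
    rw [factorProd_succ, factorProd_succ]
    refine (ih (by omega) fun j h1 h2 => hp j h1 (by omega)).mul_RA (by omega) (by omega) ?_
      (hp _ (by omega) le_rfl)
    intro x hx
    exact factorProd_fix (d := 1) (M := n - 1) (alternatingGroup (Fin (n + 1))).subtype RA (aEval n)
      (fun j h1 _ w hw y hy => RA_fix h1 hw y hy) p m (by omega)
      (fun j h1 h2 => hp j h1 (by omega)) x hx

/-- The covering map on the level of rank functions. -/
theorem covers_f (v : alternatingGroup (Fin (n + 1))) : Covers v.val (f v) := by
  have h := covers_factorProd (n := n) le_rfl (aCanon_spec v).mem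
  rwa [(aCanon_spec v).prod] at h

theorem f_inv (v : alternatingGroup (Fin (n + 1))) : f v⁻¹ = (f v)⁻¹ :=
  (covers_f v⁻¹).unique (covers_f v).inv

theorem aCanon_eq {v : alternatingGroup (Fin (n + 1))} {p : ℕ → List (ℕ × Bool)}
    (h : IsCanonical RA (aEval n) (n - 1) v p) : aCanon v = p :=
  (existsUnique_aCanonical n v).unique (aCanon_spec v) h

theorem sCanon_eq {w : Equiv.Perm (Fin n)} {p : ℕ → List ℕ}
    (h : IsCanonical RS (sEval n) (n - 1) w p) : sCanon w = p :=
  (existsUnique_sCanonical n w).unique (sCanon_spec w) h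

theorem sCanon_f (v : alternatingGroup (Fin (n + 1))) (j : ℕ) :
    sCanon (f v) j = (aCanon v j).map Prod.fst := by
  rw [sCanon_eq (p := fun j => (aCanon v j).map Prod.fst)]
  refine ⟨fun j h1 h2 => map_fst_mem_RS h1 ((aCanon_spec v).mem j h1 h2), fun j hj => ?_, rfl⟩
  simp only [(aCanon_spec v).nil j hj, List.map_nil]

end Covering

/-! ### Inversion codes and canonical factors -/

section Code

variable {n : ℕ}

/-- The number of letters smaller than `z` to the right of `z` in `w`. -/
def code (w : Equiv.Perm (Fin n)) (z : Fin n) : ℕ := #{y | y < z ∧ w⁻¹ z < w⁻¹ y}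

theorem s_lt_iff {i : ℕ} (hi : i + 1 < n) {p q : Fin n}
    (h1 : ¬ (p.val = i ∧ q.val = i + 1)) (h2 : ¬ (p.val = i + 1 ∧ q.val = i)) :
    s n (i + 1) p < s n (i + 1) q ↔ p < q := by
  rw [Fin.lt_def, Fin.lt_def, s_val (by omega) hi, s_val (by omega) hi]
  split_ifs <;> omega

/-- Exchanging an ascent moves the larger letter in front of the smaller one; only the larger letter
gains an inversion in the code. -/
theorem code_mul_s {w : Equiv.Perm (Fin n)} {i : ℕ} (hi : i + 1 < n)
    (h : w ⟨i, by omega⟩ < w ⟨i + 1, hi⟩) (z : Fin n) :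
    code (w * s n (i + 1)) z = code w z + if z = w ⟨i + 1, hi⟩ then 1 else 0 := by
  have hi' : (⟨i, by omega⟩ : Fin n) < ⟨i + 1, hi⟩ := Nat.lt_succ_self i
  unfold code
  obtain ⟨p, rfl⟩ := w.surjective z
  simp only [mul_inv_rev, s_inv, Equiv.Perm.mul_apply, Equiv.Perm.coe_inv,
    Equiv.symm_apply_apply, EmbeddingLike.apply_eq_iff_eq]
  split_ifs with hp
  · have : ({y | y < w p ∧ s n (i + 1) p < s n (i + 1) (w.symm y)} : Finset (Fin n)) =
        insert (w ⟨i, by omega⟩) ({y | y < w p ∧ p < w.symm y} : Finset (Fin n)) := by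
      ext y
      obtain ⟨q, rfl⟩ := w.surjective y
      simp only [mem_filter_univ, mem_insert, Equiv.symm_apply_apply,
        EmbeddingLike.apply_eq_iff_eq]
      by_cases hq : q = ⟨i, by omega⟩
      · subst hp hq
        rw [s_apply_left hi, s_apply_right hi]
        simp [h, hi']
      · rw [s_lt_iff hi]
        · simp [hq]
        · rintro ⟨h1, -⟩; rw [hp] at h1; simp at h1
        · rintro ⟨-, h2⟩; exact hq (Fin.ext h2)
    rw [this, card_insert_of_notMem]
    subst hp
    rw [mem_filter_univ, Equiv.symm_apply_apply]
    exact fun h' => lt_asymm h'.2 hi'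
  · rw [add_zero]
    congr 1
    ext y
    obtain ⟨q, rfl⟩ := w.surjective y
    simp only [mem_filter_univ, Equiv.symm_apply_apply]
    apply and_congr_right
    intro hlt
    apply s_lt_iff hi
    · rintro ⟨h1, h2⟩
      have e1 : p = ⟨i, by omega⟩ := Fin.ext h1
      have e2 : q = ⟨i + 1, hi⟩ := Fin.ext h2
      rw [← e1, ← e2] at h
      exact lt_asymm h hlt
    · rintro ⟨h1, h2⟩
      exact hp (Fin.ext h1)

/-- The number of inversions of a permutation. -/
def inversions (w : Equiv.Perm (Fin n)) : ℕ := ∑ z, code w z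

theorem inversions_mul_s {w : Equiv.Perm (Fin n)} {i : ℕ} (hi : i + 1 < n)
    (h : w ⟨i, by omega⟩ < w ⟨i + 1, hi⟩) :
    inversions (w * s n (i + 1)) = inversions w + 1 := by
  simp [inversions, code_mul_s hi h, sum_add_distrib]

theorem inversions_mul_s_le_iff (w : Equiv.Perm (Fin n)) {i : ℕ} (hi : i + 1 < n) :
    inversions (w * s n (i + 1)) ≤ inversions w ↔ w ⟨i + 1, hi⟩ < w ⟨i, by omega⟩ := by
  rcases lt_trichotomy (w ⟨i, by omega⟩) (w ⟨i + 1, hi⟩) with h | h | h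
  · rw [inversions_mul_s hi h]
    simp [h.le]
  · have := congrArg Fin.val (w.injective h)
    simp at this
  · have key := inversions_mul_s (w := w * s n (i + 1)) hi
      (by rwa [Equiv.Perm.mul_apply, Equiv.Perm.mul_apply, s_apply_left, s_apply_right])
    rw [mul_assoc, s_mul_self, mul_one] at key
    simp only [h, iff_true]
    omega

theorem length_sWord (j l : ℕ) : (sWord j l).length = j + 1 - l := by simp [sWord]

/-- The word carries the letter `j` leftwards, one place per generator, and each time past a smaller
letter. -/
theorem code_mul_sWord {Q : Equiv.Perm (Fin n)} {j l : ℕ} (hj : j < n)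
    (hfix : ∀ x : Fin n, j ≤ x.val → Q x = x) (hl : l ≤ j + 1) (h1 : 1 ≤ l) (z : Fin n) :
    code (Q * sEval n (sWord j l)) z = code Q z + if z.val = j then j + 1 - l else 0 := by
  induction hl using Nat.decreasingInduction with
  | self => simp [sWord_self, sEval]
  | of_succ l hl ih =>
    obtain ⟨i, rfl⟩ : ∃ i, l = i + 1 := ⟨l - 1, by omega⟩
    specialize ih (by omega)
    set w := Q * sEval n (sWord j (i + 1 + 1)) with hw
    have e : Q * sEval n (sWord j (i + 1)) = w * s n (i + 1) := by
      rw [sWord_succ (by omega), sEval_append, ← mul_assoc]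
      simp [hw, sEval]
    have htop : w ⟨i + 1, by omega⟩ = ⟨j, hj⟩ := by
      rw [hw, Equiv.Perm.mul_apply]
      have h2 : sEval n (sWord j (i + 1 + 1)) ⟨i + 1, by omega⟩ = ⟨j, hj⟩ :=
        Fin.ext (sEval_top (by omega) hj _ rfl)
      rw [h2, hfix _ le_rfl]
    have hlt : w ⟨i, by omega⟩ < w ⟨i + 1, by omega⟩ := by
      rw [htop, Fin.lt_def]
      -- Letters above `j` are fixed by `w`, and `j` itself is at place `i + 1`; neither can be at
      -- place `i`.
      by_contra h2
      rcases (not_lt.1 h2).eq_or_lt with h3 | h3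
      · have h4 := congrArg Fin.val (w.injective ((Fin.ext h3).symm.trans htop.symm))
        simp at h4
      · simp only at h3
        have h4 : w (w ⟨i, by omega⟩) = w ⟨i, by omega⟩ := by
          conv_lhs => rw [hw]
          rw [Equiv.Perm.mul_apply, sEval_fix (by omega) _ h3, hfix _ (le_of_lt h3)]
        have h5 := congrArg Fin.val (w.injective h4)
        simp only at h5
        omega
    rw [e, code_mul_s (by omega) hlt, ih, htop]
    simp only [Fin.ext_iff]
    split_ifs <;> omega

theorem RS_fix {j : ℕ} {u : List ℕ} (hu : u ∈ RS j) (x : Fin n) (hx : j < x.val) :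
    sEval n u x = x := by
  obtain ⟨l, -, h2, rfl⟩ := hu
  exact sEval_fix h2 x hx

theorem code_factorProd {p : ℕ → List ℕ} {m : ℕ} (hm : m ≤ n - 1)
    (hp : ∀ j, 1 ≤ j → j ≤ m → p j ∈ RS j) (z : Fin n) :
    code (factorProd (sEval n) p m) z =
      if 1 ≤ z.val ∧ z.val ≤ m then (p z.val).length else 0 := by
  induction m with
  | zero =>
    rw [if_neg (by omega)]
    simp only [code, factorProd, List.range'_zero, List.map_nil, List.prod_nil, inv_one,
      Equiv.Perm.one_apply, card_eq_zero, filter_eq_empty_iff]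
    intro y _ h
    exact lt_asymm h.1 h.2
  | succ m ih =>
    rw [factorProd_succ]
    obtain ⟨l, h1, h2, h3⟩ := hp (m + 1) (by omega) le_rfl
    rw [h3, code_mul_sWord (by omega) _ h2 h1, ih (by omega) fun j h4 h5 => hp j h4 (by omega)]
    · by_cases hz : z.val = m + 1
      · rw [if_neg (by omega), if_pos hz, if_pos (by omega), hz, h3, length_sWord, zero_add]
      · rw [if_neg hz, add_zero]
        congr 1
        apply propext
        omega
    · intro x hx
      exact factorProd_fix (d := 0) (M := n - 1) (MonoidHom.id _) RS (sEval n)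
        (fun j _ _ w hw y hy => RS_fix hw y hy) p m (by omega)
        (fun j h1 h2 => hp j h1 (by omega)) x hx

theorem length_sCanon (w : Equiv.Perm (Fin n)) (z : Fin n) :
    (sCanon w z.val).length = code w z := by
  have h := code_factorProd le_rfl (sCanon_spec w).mem z
  rw [(sCanon_spec w).prod] at h
  rw [h]
  split_ifs with h1
  · rfl
  · rw [(sCanon_spec w).nil _ h1, List.length_nil]

theorem sum_length_sCanon (w : Equiv.Perm (Fin n)) :
    ∑ j ∈ Icc 1 (n - 1), (sCanon w j).length = inversions w := by
  simp only [inversions, ← length_sCanon, Fin.sum_univ_eq_sum_range fun j => (sCanon w j).length]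
  apply sum_subset
  · intro j hj
    rw [mem_Icc] at hj
    rw [mem_range]
    omega
  · intro j _ hj
    rw [mem_Icc] at hj
    rw [(sCanon_spec w).nil j hj, List.length_nil]

theorem code_eq_val_iff (w : Equiv.Perm (Fin n)) (z : Fin n) :
    code w z = z.val ↔ ∀ y < z, w⁻¹ z < w⁻¹ y := by
  have h : #({y | y < z} : Finset (Fin n)) = z.val := by
    have : ({y | y < z} : Finset (Fin n)) = Iio z := by ext; simp
    rw [this, Fin.card_Iio]
  unfold code
  rw [← filter_filter]
  conv_lhs => rhs; rw [← h]
  rw [card_filter_eq_iff]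
  simp

/-- The code of `z` is at most `z`, with equality exactly if all smaller letters are to the right.
The empty factor at `z = 0` fits, since `sWord 0 1` is empty. -/
theorem sCanon_eq_sWord_one_iff (w : Equiv.Perm (Fin n)) (z : Fin n) :
    sCanon w z.val = sWord z.val 1 ↔ ∀ y < z, w⁻¹ z < w⁻¹ y := by
  rw [← code_eq_val_iff, ← length_sCanon]
  constructor
  · intro h
    rw [h, length_sWord]
    omega
  · intro h
    by_cases hz : 1 ≤ z.val
    · obtain ⟨l, h1, h2, h3⟩ := (sCanon_spec w).mem z hz (by omega)
      rw [h3, length_sWord] at h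
      rw [h3, show l = 1 by omega]
    · have hz : z.val = 0 := by omega
      rw [(sCanon_spec w).nil _ (by omega), hz]
      rfl

end Code

/-! ### Statistics on the alternating group read off from the covered permutation -/

section Statistics

variable {n : ℕ}

theorem lenA_eq (v : alternatingGroup (Fin (n + 1))) : lenA v = inversions (f v) := by
  rw [← sum_length_sCanon]
  simp [lenA, sCanon_f]

theorem zero_notMem_DesA (v : alternatingGroup (Fin (n + 1))) : 0 ∉ DesA v := by
  simp [DesA]

/-- The descents of `v` are the descents of the permutation covered by `v`. -/
theorem succ_mem_DesA (v : alternatingGroup (Fin (n + 1))) (i : ℕ) :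
    i + 1 ∈ DesA v ↔ ∃ h : i + 1 < n, f v ⟨i + 1, h⟩ < f v ⟨i, by omega⟩ := by
  by_cases hi : i + 1 < n
  · simp only [DesA, mem_filter, mem_Icc, ge_iff_le, hi, exists_true_left]
    rw [lenA_eq, lenA_eq]
    have e : (v * a n (i + 1)).val = v.val * s (n + 1) 1 * s (n + 1) (i + 2) := by
      rw [Subgroup.coe_mul, a_val (by omega) hi, mul_assoc]
    have h := covers_f (v * a n (i + 1))
    rw [e] at h
    -- Either `f (v a_i) = f v * s_i`, the classical situation, or `f (v a_i) = f v`. In the latter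
    -- case the lengths agree, so the weak inequality in the definition counts a descent, and `f v`
    -- does have one.
    rcases (covers_f v).mul_s_one.mul_s_cases hi with h1 | ⟨h1, h2⟩
    · rw [h.unique h1, inversions_mul_s_le_iff _ hi]
      constructor
      · exact fun h => h.2
      · exact fun h => ⟨by omega, h⟩
    · rw [h.unique h1]
      simp only [h2, le_refl, and_true, iff_true]
      omega
  · simp only [hi, DesA, mem_filter, mem_Icc, IsEmpty.exists_iff, iff_false]
    omega

/-- The elements of `Del_A(v⁻¹)` correspond to the left-to-right minima of the permutation
covered by `v`. -/
theorem mem_DelA_inv (v : alternatingGroup (Fin (n + 1))) (k : ℕ) :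
    k ∈ DelA v⁻¹ ↔ ∃ z : Fin n, z.val + 2 = k ∧ 1 ≤ z.val ∧ ∀ y < z, (f v)⁻¹ z < (f v)⁻¹ y := by
  have hrk : ∀ j : Fin (n + 1), #{i : Fin (n + 1) | i < j ∧ (v⁻¹).val i < (v⁻¹).val j} =
      rk (v⁻¹).val j ((v⁻¹).val j) := fun j => rfl
  have hmin : ∀ z : Fin n, rk (f v)⁻¹ z ((f v)⁻¹ z) = 0 ↔ ∀ y < z, (f v)⁻¹ z < (f v)⁻¹ y := by
    intro z
    simp only [rk, card_eq_zero, filter_eq_empty_iff, mem_univ, true_implies, not_and, not_lt]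
    refine forall₂_congr fun y hy => ?_
    rw [← Fin.le_def, le_iff_lt_or_eq, or_iff_left]
    intro h
    exact (Fin.ne_of_lt hy).symm ((f v)⁻¹.injective h)
  simp only [DelA, hrk, mem_image, mem_filter_univ]
  constructor
  · rintro ⟨j, ⟨h1, h2⟩, rfl⟩
    refine ⟨⟨j.val - 1, by omega⟩, by simp only; omega, by simp only; omega, ?_⟩
    rw [← hmin, ← Covers.rk_le_one_iff (covers_f v).inv]
    have : (⟨j.val - 1 + 1, by omega⟩ : Fin (n + 1)) = j := Fin.ext (by simp only; omega)
    rw [this]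
    simp only [show j.val - 1 + 1 = j.val by omega]
    exact h2
  · rintro ⟨z, rfl, h1, h2⟩
    refine ⟨⟨z.val + 1, by omega⟩, ⟨by simp only; omega, ?_⟩, rfl⟩
    rw [← hmin, ← Covers.rk_le_one_iff (covers_f v).inv] at h2
    exact h2

/-- The count of earlier smaller entries at `j` is the count for `v⁻¹` at `v j`, so `v` maps one
extended set `E` onto the other. The extension adds the first two positions, which always meet the
condition. -/
theorem delA_inv (v : alternatingGroup (Fin (n + 1))) : delA v⁻¹ = delA v := by
  set E : alternatingGroup (Fin (n + 1)) → Finset (Fin (n + 1)) :=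
    fun u => {j | rk u.val j (u.val j) ≤ 1} with hE
  have hdel : ∀ u, delA u + #({j | j.val < 2} : Finset (Fin (n + 1))) = #(E u) := by
    intro u
    rw [delA, DelA, card_image_of_injective _ fun x y h => Fin.ext (by simpa using h),
      ← card_union_of_disjoint]
    · congr 1
      ext j
      simp only [hE, mem_union, mem_filter_univ]
      have h1 : rk u.val j (u.val j) ≤ j.val := by
        have := rk_mono_right u.val j.val (Fin.isLt (u.val j)).le
        simp only at this
        rwa [rk_top _ j.isLt.le] at this
      constructor
      · rintro (h | h)
        · exact h.2
        · omega
      · intro h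
        by_cases h2 : j.val < 2
        · exact Or.inr h2
        · exact Or.inl ⟨by omega, h⟩
    · rw [disjoint_left]
      intro j h1 h2
      rw [mem_filter_univ] at h1 h2
      omega
  have hcard : #(E v⁻¹) = #(E v) := by
    symm
    refine card_bij (fun j _ => v.val j) ?_ ?_ ?_
    · intro j hj
      simp only [hE, mem_filter_univ] at hj ⊢
      rw [Subgroup.coe_inv, rk_inv]
      simpa using hj
    · intro j _ j' _ h
      exact v.val.injective h
    · intro j hj
      simp only [hE, mem_filter_univ] at hj
      rw [Subgroup.coe_inv, rk_inv] at hj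
      refine ⟨v.val⁻¹ j, ?_, by simp⟩
      simp only [hE, mem_filter_univ]
      simpa using hj
  have h1 := hdel v
  have h2 := hdel v⁻¹
  omega

end Statistics

/-! ### The right-to-left Foata transformation on permutations -/

section PermWords

variable {n : ℕ}

theorem countP_ofFn {X : Type*} (p : X → Prop) [DecidablePred p] (u : Fin n → X) :
    (List.ofFn u).countP p = ∑ i, if p (u i) then 1 else 0 := by
  induction n with
  | zero => simp
  | succ n ih =>
    rw [List.ofFn_succ, List.countP_cons, ih, Fin.sum_univ_succ, add_comm]
    simp

theorem noninv_reverse_ofFn {X : Type*} [LinearOrder X] (u : Fin n → X) :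
    noninv (List.ofFn u).reverse = ∑ i, ∑ j, if i < j ∧ u j ≤ u i then 1 else 0 := by
  induction n with
  | zero => simp [noninv]
  | succ n ih =>
    rw [List.ofFn_succ, List.reverse_cons, noninv_concat, ih, List.countP_reverse, countP_ofFn,
      Fin.sum_univ_succ, add_comm]
    simp only [Fin.sum_univ_succ, Fin.not_lt_zero, Fin.succ_pos, Fin.succ_lt_succ_iff, false_and,
      if_false, zero_add, true_and]

theorem noninv_reverse_toWord (w : Equiv.Perm (Fin n)) :
    noninv (toWord w).reverse = inversions w := by
  rw [toWord, noninv_reverse_ofFn, inversions]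
  conv_rhs => rw [← Equiv.sum_comp w]
  refine sum_congr rfl fun i _ => ?_
  rw [code, card_filter]
  conv_rhs => rw [← Equiv.sum_comp w]
  refine sum_congr rfl fun j _ => ?_
  congr 1
  simp only [Equiv.Perm.coe_inv, Equiv.symm_apply_apply, eq_iff_iff]
  constructor
  · rintro ⟨h1, h2⟩
    exact ⟨lt_of_le_of_ne h2 fun h => h1.ne' (w.injective h), h1⟩
  · rintro ⟨h1, h2⟩
    exact ⟨h2, h1.le⟩

theorem revMaj_ofFn {X : Type*} [LinearOrder X] (u : Fin n → X) :
    revMaj (List.ofFn u) =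
      ∑ i : Fin n, if ∃ h : i.val + 1 < n, u ⟨i.val + 1, h⟩ ≤ u i then n - (i.val + 1) else 0 := by
  induction n with
  | zero => simp [revMaj]
  | succ n ih =>
    rw [List.ofFn_succ, revMaj, ih, Fin.sum_univ_succ, add_comm]
    congr 1
    · refine if_congr ?_ (by simp) rfl
      cases n with
      | zero =>
        constructor
        · rintro ⟨y, hy, -⟩
          simp at hy
        · rintro ⟨h, -⟩
          simp at h
      | succ n =>
        rw [List.ofFn_succ, List.head?_cons]
        simp only [Option.mem_def, Option.some.injEq, exists_eq_left']
        exact ⟨fun h => ⟨by simp, h⟩, fun ⟨_, h⟩ => h⟩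
    · refine sum_congr rfl fun i _ => ?_
      simp [Fin.succ]

theorem toWord_rev (w : Equiv.Perm (Fin n)) : toWord (rev w) = (toWord w).reverse := by
  apply List.ext_getElem
  · simp [toWord]
  · intro i h1 h2
    simp only [toWord, rev, List.getElem_ofFn, List.getElem_reverse, List.length_ofFn,
      Equiv.Perm.mul_apply, Fin.revPerm_apply]
    congr 1
    ext
    simp only [Fin.val_rev]
    omega

theorem toWord_injective : Function.Injective (toWord (n := n)) := fun _ _ h =>
  Equiv.coe_fn_injective (List.ofFn_injective h)

theorem toWord_Phi (w : Equiv.Perm (Fin n)) : toWord (Phi w) = PhiWord (toWord w) :=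
  toWord_ofWord _ _ _

theorem toWord_rtlPhi (w : Equiv.Perm (Fin n)) :
    toWord (rtlPhi w) = (PhiWord (toWord w).reverse).reverse := by
  rw [rtlPhi, toWord_rev, toWord_Phi, toWord_rev]

theorem rtlPhi_injective : Function.Injective (rtlPhi (n := n)) := by
  intro w w' h
  have h1 := congrArg toWord h
  rw [toWord_rtlPhi, toWord_rtlPhi] at h1
  exact toWord_injective (List.reverse_injective (PhiWord_injective (List.reverse_injective h1)))

theorem inversions_rtlPhi (w : Equiv.Perm (Fin n)) :
    inversions (rtlPhi w) = revMaj (toWord w) := by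
  rw [← noninv_reverse_toWord, toWord_rtlPhi, List.reverse_reverse, noninv_PhiWord]

/-- The first letter of `w` satisfying `q`. -/
theorem head?_filter_toWord (w : Equiv.Perm (Fin n)) (q : Fin n → Bool) (z : Fin n) :
    ((toWord w).filter q).head? = some z ↔ q z ∧ ∀ y, q y → y ≠ z → w⁻¹ z < w⁻¹ y := by
  rw [List.head?_filter, List.find?_eq_some_iff_getElem]
  apply and_congr_right
  intro hz
  constructor
  · rintro ⟨i, hi, h1, h2⟩ y hy hyz
    have hi' : i < n := by simpa [toWord] using hi
    have h3 : w ⟨i, hi'⟩ = z := by simpa [toWord] using h1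
    have h4 : w⁻¹ z = ⟨i, hi'⟩ := by rw [← h3]; simp
    rw [h4]
    by_contra hlt
    rcases (not_lt.1 hlt).eq_or_lt with h5 | h5
    · apply hyz
      rw [← h3, ← h5]
      simp
    · have h6 := h2 (w⁻¹ y).val h5
      simp [toWord, hy] at h6
  · intro h
    refine ⟨(w⁻¹ z).val, by simp [toWord], by simp [toWord], ?_⟩
    intro j hj
    have hj' : j < n := by omega
    by_contra h1
    have h2 := h (w ⟨j, hj'⟩) (by simpa [toWord] using h1)
    have h3 : w ⟨j, hj'⟩ ≠ z := by
      rintro rfl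
      simp at hj
    have h4 := h2 h3
    rw [Fin.lt_def] at h4
    simp at h4 hj
    omega

theorem head?_filter_toWord_rtlPhi (w : Equiv.Perm (Fin n)) (q : Fin n → Bool) :
    ((toWord (rtlPhi w)).filter q).head? = ((PhiWord (toWord w).reverse).filter q).getLast? := by
  rw [toWord_rtlPhi, List.filter_reverse, List.head?_reverse]

theorem head?_filter_eq_getLast? (w : Equiv.Perm (Fin n)) (q : Fin n → Bool) :
    ((toWord w).filter q).head? = ((toWord w).reverse.filter q).getLast? := by
  rw [List.filter_reverse, List.getLast?_reverse]

/-- `rtlPhi` preserves the set of left-to-right minima. -/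
theorem rtlPhi_min_iff (w : Equiv.Perm (Fin n)) (z : Fin n) :
    (∀ y < z, (rtlPhi w)⁻¹ z < (rtlPhi w)⁻¹ y) ↔ ∀ y < z, w⁻¹ z < w⁻¹ y := by
  -- A letter `z` is a left-to-right minimum exactly if it comes first among the letters `≤ z`,
  -- hence last in the reversed word.
  have key : ∀ u : Equiv.Perm (Fin n), (∀ y < z, u⁻¹ z < u⁻¹ y) ↔
      ((toWord u).filter (· ≤ z)).head? = some z := by
    intro u
    rw [head?_filter_toWord]
    simp only [decide_eq_true_eq, le_refl, true_and, lt_iff_le_and_ne, and_imp]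
  rw [key, key, head?_filter_toWord_rtlPhi, getLast?_filter_PhiWord, head?_filter_eq_getLast?]

/-- `rtlPhi` preserves the descents of the inverse permutation. -/
theorem rtlPhi_inv_lt_iff (w : Equiv.Perm (Fin n)) {b c : Fin n} (hbc : b ⋖ c) :
    (rtlPhi w)⁻¹ c < (rtlPhi w)⁻¹ b ↔ w⁻¹ c < w⁻¹ b := by
  have key : ∀ u : Equiv.Perm (Fin n), u⁻¹ c < u⁻¹ b ↔
      ((toWord u).filter (fun y => y = b ∨ y = c)).head? = some c := by
    intro u
    rw [head?_filter_toWord]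
    simp only [decide_eq_true_eq, or_true, true_and]
    constructor
    · rintro h y (rfl | rfl) hy
      · exact h
      · exact absurd rfl hy
    · exact fun h => h b (Or.inl rfl) hbc.1.ne
  rw [key, key, head?_filter_toWord_rtlPhi, head?_filter_eq_getLast?,
    filter_PhiWord hbc (List.nodup_reverse.2 (toWord_nodup w))]

end PermWords

/-! ### The map `Psi` -/

section Psi

variable {n : ℕ}

theorem sCanon_rtlPhi_iff (w : Equiv.Perm (Fin n)) {j : ℕ} (hj : j < n) :
    sCanon (rtlPhi w) j = sWord j 1 ↔ sCanon w j = sWord j 1 := by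
  have h1 := sCanon_eq_sWord_one_iff (rtlPhi w) ⟨j, hj⟩
  have h2 := sCanon_eq_sWord_one_iff w ⟨j, hj⟩
  rw [rtlPhi_min_iff] at h1
  exact h1.trans h2.symm

theorem aCanon_Psi (v : alternatingGroup (Fin (n + 1))) :
    aCanon (Psi v) = fun j =>
      if sCanon (rtlPhi (f v)) j = sWord j 1 then aCanon v j
      else (sCanon (rtlPhi (f v)) j).map fun i => (i, true) := by
  refine aCanon_eq ⟨fun j h1 h2 => ?_, fun j hj => ?_, rfl⟩
  · split_ifs
    · exact (aCanon_spec v).mem j h1 h2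
    · obtain ⟨l, h3, h4, h5⟩ := (sCanon_spec (rtlPhi (f v))).mem j h1 h2
      rw [h5]
      exact Or.inl ⟨l, h3, h4, rfl⟩
  · simp only [(aCanon_spec v).nil j hj, (sCanon_spec (rtlPhi (f v))).nil j hj, List.map_nil,
      ite_self]

/-- A full factor of `rtlPhi (f v)` is lifted to the factor of `v` at the same place. That factor
does cover `s_j ⋯ s_1`, because `f v` is full at the same places. -/
theorem f_Psi (v : alternatingGroup (Fin (n + 1))) : f (Psi v) = rtlPhi (f v) := by
  rw [← (sCanon_spec (rtlPhi (f v))).prod, f, aCanon_Psi]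
  apply factorProd_congr
  intro j h1 h2
  simp only
  split_ifs with h
  · rw [h, ← sCanon_f, (sCanon_rtlPhi_iff (f v) (by omega)).1 h]
  · simp [Function.comp_def]

/-- `Psi v` determines `rtlPhi (f v)`, hence `f v`. At the full places the factors of `v` can be
read off from `Psi v`; at the others they are determined by `f v`. -/
theorem Psi_injective : Function.Injective (Psi (n := n)) := by
  intro v v' h
  have hf : f v = f v' := by
    apply rtlPhi_injective
    rw [← f_Psi, ← f_Psi, h]
  have hmem : ∀ u ∈ ({v, v'} : Set (alternatingGroup (Fin (n + 1)))), ∀ j, 1 ≤ j → j ≤ n - 1 →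
      sCanon (f u) j ≠ sWord j 1 → aCanon u j = (sCanon (f u) j).map fun i => (i, true) := by
    intro u _ j h1 h2 hne
    rw [sCanon_f] at hne ⊢
    rcases (aCanon_spec u).mem j h1 h2 with ⟨l, -, -, hl⟩ | hl
    · rw [hl, map_fst_aWord]
      rfl
    · rw [hl, map_fst_aWord_inv h1] at hne
      exact absurd rfl hne
  have hcanon : ∀ j, 1 ≤ j → j ≤ n - 1 → aCanon v j = aCanon v' j := by
    intro j h1 h2
    by_cases hj : sCanon (f v) j = sWord j 1
    · have h3 := congrFun (aCanon_Psi v) j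
      have h4 := congrFun (aCanon_Psi v') j
      have h5 := (sCanon_rtlPhi_iff (f v) (show j < n by omega)).2 hj
      rw [← hf, ← h] at h4
      simp only [h5, if_true] at h3 h4
      exact h3.symm.trans h4
    · rw [hmem v (by simp) j h1 h2 hj, hmem v' (by simp) j h1 h2 (hf ▸ hj), hf]
  rw [← (aCanon_spec v).prod, ← (aCanon_spec v').prod]
  exact factorProd_congr _ hcanon

theorem rmajA_eq (v : alternatingGroup (Fin (n + 1))) : rmajA v = revMaj (toWord (f v)) := by
  have hsub : DesA v ⊆ range (n + 1) := by
    intro i hi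
    rw [DesA, mem_filter, mem_Icc] at hi
    rw [mem_range]
    omega
  rw [toWord, revMaj_ofFn, rmajA, ← inter_eq_right.2 hsub, ← sum_ite_mem, sum_range_succ',
    if_neg (zero_notMem_DesA v), add_zero,
    ← Fin.sum_univ_eq_sum_range fun i => if i + 1 ∈ DesA v then n - (i + 1) else 0]
  refine sum_congr rfl fun i _ => ?_
  congr 1
  rw [succ_mem_DesA, eq_iff_iff]
  refine exists_congr fun h => ?_
  -- `revMaj` counts weak descents, but a permutation has no repeated letters.
  rw [le_iff_lt_or_eq, or_iff_left]
  intro h1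
  have := congrArg Fin.val ((f v).injective h1)
  simp at this

theorem rmajA_eq_lenA_Psi (v : alternatingGroup (Fin (n + 1))) : rmajA v = lenA (Psi v) := by
  rw [rmajA_eq, lenA_eq, f_Psi, inversions_rtlPhi]

theorem DelA_inv_Psi (v : alternatingGroup (Fin (n + 1))) : DelA v⁻¹ = DelA (Psi v)⁻¹ := by
  ext k
  simp only [mem_DelA_inv, f_Psi, rtlPhi_min_iff]

/-- The transformation keeps left-to-right minima as letters, not as positions, so the count is
compared through the inverses. -/
theorem delA_Psi (v : alternatingGroup (Fin (n + 1))) : delA v = delA (Psi v) := by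
  rw [← delA_inv, ← delA_inv (Psi v), delA, delA, DelA_inv_Psi]

theorem DesA_inv_Psi (v : alternatingGroup (Fin (n + 1))) : DesA v⁻¹ = DesA (Psi v)⁻¹ := by
  ext i
  cases i with
  | zero => simp only [zero_notMem_DesA]
  | succ i =>
    simp only [succ_mem_DesA, f_inv, f_Psi]
    refine exists_congr fun h => ?_
    rw [rtlPhi_inv_lt_iff]
    refine ⟨Fin.lt_def.2 (Nat.lt_succ_self i), fun d h1 h2 => ?_⟩
    rw [Fin.lt_def] at h1 h2
    simp only at h1 h2
    omega

end Psi

end AltFoata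

/-! ### The main theorem -/

theorem mainTheorem1 (n : ℕ) :
    Function.Bijective (AltFoata.Psi : alternatingGroup (Fin (n + 1)) → _) ∧
    (∀ v : alternatingGroup (Fin (n + 1)),
      AltFoata.rmajA v = AltFoata.lenA (AltFoata.Psi v)) ∧
    (∀ v : alternatingGroup (Fin (n + 1)),
      AltFoata.delA v = AltFoata.delA (AltFoata.Psi v)) ∧
    (∀ v : alternatingGroup (Fin (n + 1)),
      AltFoata.DelA v⁻¹ = AltFoata.DelA (AltFoata.Psi v)⁻¹) ∧
    (∀ v : alternatingGroup (Fin (n + 1)),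
      AltFoata.DesA v⁻¹ = AltFoata.DesA (AltFoata.Psi v)⁻¹) ∧
    (∀ D₁ D₂ : Finset ℕ,
      ∑ v : alternatingGroup (Fin (n + 1)) with
          AltFoata.DesA v⁻¹ ⊆ D₁ ∧ AltFoata.DelA v⁻¹ ⊆ D₂,
        (Polynomial.X : Polynomial ℤ) ^ AltFoata.rmajA v =
      ∑ v : alternatingGroup (Fin (n + 1)) with
          AltFoata.DesA v⁻¹ ⊆ D₁ ∧ AltFoata.DelA v⁻¹ ⊆ D₂,
        (Polynomial.X : Polynomial ℤ) ^ AltFoata.lenA v) := by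
  have hbij : Function.Bijective (AltFoata.Psi : alternatingGroup (Fin (n + 1)) → _) :=
    Finite.injective_iff_bijective.1 AltFoata.Psi_injective
  refine ⟨hbij, AltFoata.rmajA_eq_lenA_Psi, AltFoata.delA_Psi, AltFoata.DelA_inv_Psi,
    AltFoata.DesA_inv_Psi, fun D₁ D₂ => ?_⟩
  -- Reindexing by `Psi` respects the summation conditions, which involve only the two sets attached
  -- to the inverse.
  refine Finset.sum_bijective AltFoata.Psi hbij (fun v => ?_) fun v _ => ?_
  · simp only [Finset.mem_filter_univ, AltFoata.DelA_inv_Psi v, AltFoata.DesA_inv_Psi v]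
  · rw [AltFoata.rmajA_eq_lenA_Psi]
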